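/- Let $k$ be a field, let $\Omega$ be an algebraically closed field containing $k$ (for instance $\Omega=\overline{k}$), and let $F\in k[X_0,X_1,X_2]$ be a homogeneous polynomial of degree $f$ that is reduced (squarefree) over $\Omega$. For a point $P\in\mathbb{P}^2(\Omega)$ of the plane curve $V(F)$ let $\mathcal{O}_P$ be the local ring of $V(F)$ at $P$ (over $\Omega$), let $\widetilde{\mathcal{O}}_P$ be its integral closure in its total ring of fractions, and put $$\delta(P):=\dim_\Omega \widetilde{\mathcal{O}}_P/\mathcal{O}_P,\qquad \delta:=\sum_{P\in V(F)}\delta(P),\qquad g:=\binom{f-1}{2}-\delta ,$$ where the integer $g$ is called the geometric genus of the normalization of $V(F)$ (it may be negative if $V(F)$ is reducible). Suppose that $F=HK$ with $H,K\in\Omega[X_0,X_1,X_2]$ and $h:=\deg H\le \deg K$. Then $$h(f-h)\le \tfrac12 (f-1)(f-2)-g .$$ -/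

import Mathlib

open scoped LinearAlgebra.Projectivization

/-- The local ring of the projective plane over `Ω` at the point `P`: all rational functions `N / D`
with `N` and `D` homogeneous polynomials of the same degree in three variables and `D` not
vanishing at `P`. It is a subalgebra of the field `Ω(X₀, X₁, X₂)`. -/
noncomputable def planeLocalRing {Ω : Type*} [Field Ω] (P : ℙ Ω (Fin 3 → Ω)) :
    Subalgebra Ω (FractionRing (MvPolynomial (Fin 3) Ω)) where
  carrier := {z | ∃ (d : ℕ) (N D : MvPolynomial (Fin 3) Ω),
    N.IsHomogeneous d ∧ D.IsHomogeneous d ∧ MvPolynomial.eval P.rep D ≠ 0 ∧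
      z = algebraMap _ (FractionRing (MvPolynomial (Fin 3) Ω)) N / algebraMap _ _ D}
  mul_mem' := by
    rintro _ _ ⟨d, N, D, hN, hD, hP, rfl⟩ ⟨d', N', D', hN', hD', hP', rfl⟩
    refine ⟨d + d', N * N', D * D', hN.mul hN', hD.mul hD', ?_, ?_⟩
    · rw [map_mul]
      exact mul_ne_zero hP hP'
    · rw [map_mul, map_mul, div_mul_div_comm]
  add_mem' := by
    rintro _ _ ⟨d, N, D, hN, hD, hP, rfl⟩ ⟨d', N', D', hN', hD', hP', rfl⟩
    have key : ∀ E : MvPolynomial (Fin 3) Ω, MvPolynomial.eval P.rep E ≠ 0 →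
        algebraMap _ (FractionRing (MvPolynomial (Fin 3) Ω)) E ≠ 0 := by
      intro E hE h0
      have hE0 : E = 0 := (IsFractionRing.injective (MvPolynomial (Fin 3) Ω)
        (FractionRing (MvPolynomial (Fin 3) Ω))) (by rw [h0, map_zero])
      exact hE (by rw [hE0, map_zero])
    refine ⟨d + d', N * D' + D * N', D * D', (hN.mul hD').add (hD.mul hN'), hD.mul hD', ?_, ?_⟩
    · rw [map_mul]
      exact mul_ne_zero hP hP'
    · rw [div_add_div _ _ (key D hP) (key D' hP'), map_add, map_mul, map_mul, map_mul]
  algebraMap_mem' := by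
    intro c
    refine ⟨0, MvPolynomial.C c, 1, MvPolynomial.isHomogeneous_C _ _,
      MvPolynomial.isHomogeneous_one _ _, by simp, ?_⟩
    rw [map_one, div_one, IsScalarTower.algebraMap_apply Ω (MvPolynomial (Fin 3) Ω)
      (FractionRing (MvPolynomial (Fin 3) Ω)), MvPolynomial.algebraMap_eq]

/-- The ideal of the plane curve `V(F)` in the local ring of the plane at `P`: it is generated by the
functions `F G / D` with `F G` and `D` homogeneous of the same degree and `D` not vanishing
at `P`. -/
noncomputable def curveIdeal {Ω : Type*} [Field Ω] (F : MvPolynomial (Fin 3) Ω)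
    (P : ℙ Ω (Fin 3 → Ω)) : Ideal (planeLocalRing P) :=
  Ideal.span {z | ∃ (d : ℕ) (G D : MvPolynomial (Fin 3) Ω),
    (F * G).IsHomogeneous d ∧ D.IsHomogeneous d ∧ MvPolynomial.eval P.rep D ≠ 0 ∧
      (z : FractionRing (MvPolynomial (Fin 3) Ω)) =
        algebraMap _ (FractionRing (MvPolynomial (Fin 3) Ω)) (F * G) / algebraMap _ _ D}

/-- The local ring of the plane curve `V(F)` at the point `P`. -/
abbrev curveLocalRing {Ω : Type*} [Field Ω] (F : MvPolynomial (Fin 3) Ω)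
    (P : ℙ Ω (Fin 3 → Ω)) : Type _ :=
  planeLocalRing P ⧸ curveIdeal F P

/-- The delta invariant of a `κ`-algebra `O`: the dimension over `κ` of the quotient of the
normalization of `O` (the integral closure of `O` in its total ring of fractions) by `O`. -/
noncomputable def deltaInvariant (κ : Type*) [Field κ] (O : Type*) [CommRing O] [Algebra κ O] : ℕ :=
  Module.finrank κ (integralClosure O (FractionRing O) ⧸
    LinearMap.range (Algebra.linearMap O (integralClosure O (FractionRing O))))

/-- The delta invariant `δ(P)` of the plane curve `V(F)` at the point `P`. -/
noncomputable def deltaAt {Ω : Type*} [Field Ω] (F : MvPolynomial (Fin 3) Ω)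
    (P : ℙ Ω (Fin 3 → Ω)) : ℕ :=
  deltaInvariant Ω (curveLocalRing F P)

/-- The sum `δ` of the delta invariants over all points of `V(F)`. -/
noncomputable def totalDelta {Ω : Type*} [Field Ω] (F : MvPolynomial (Fin 3) Ω) : ℕ :=
  ∑ᶠ (P : ℙ Ω (Fin 3 → Ω)) (_ : MvPolynomial.eval P.rep F = 0), deltaAt F P

/-- The geometric genus `binom(f - 1, 2) - δ` of the normalization of a reduced plane curve `V(F)` of
degree `f`. It can be negative when `V(F)` is reducible. -/
noncomputable def normalizationGenus {Ω : Type*} [Field Ω] (F : MvPolynomial (Fin 3) Ω)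
    (f : ℕ) : ℤ :=
  ((f - 1).choose 2 : ℤ) - (totalDelta F : ℤ)

/-!
Since `g = (f - 1)(f - 2) / 2 - δ`, the claim is that `h * k ≤ δ` for a squarefree form `H * K` with
`H` and `K` of degrees `h` and `k`: the intersection number of two curves without common component
is at most the sum of the delta invariants of their union.

The reason is local. Let `O` be the local ring of the union at a point `P`, and let `x` and `y` be
the local equations of the two curves, so that `x * y = 0` in `O`. The idempotent `e = x / (x + y)`
is integral over `O`, and `r * e` lies in `O` only if `r` lies in the ideal `(x, y)`. Hence
`O / (x, y)` embeds into the normalization modulo `O`, and the delta invariant at `P` is at least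
the intersection number at `P` (`exists_linearMap_normalizationQuotient`, `exists_linearMap_forms`).

The global input is a form of Bézout's theorem that does not mention local intersection numbers. In
large degrees, the forms modulo the ideal `(H, K)` have dimension `h * k` (`finrank_formsMod`), and
a form that lies in the ideal `(H, K)` locally at every common zero lies in the ideal
(`mem_span_pair_of_forall_local`). Therefore the forms modulo `(H, K)` embed into the direct sum of
the normalizations modulo the local rings (`mul_le_totalDelta`).

As `Module.finrank` and `finsum` are zero where the dimension or the support is infinite, the
inequality also needs that the delta invariants are finite and vanish outside a finite set. This
follows from an element of the conductor: after a general linear change of coordinates, the equation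
`F` of the curve is a monic polynomial in one variable `w` without a factor in common with
`∂F/∂w`, and `∂F/∂w` multiplies the normalization into the local ring. This is shown by Lagrange
interpolation at the roots of `F` in an algebraic closure (`exists_dvd_derivative_mul_sub`,
`exists_dirDerivGerm_mul_sub_mem`). The common zeros of `F` and `∂F/∂w` are finite in number, and
the local ring modulo the two has finite dimension (`finite_setOf_eval_eq_zero`,
`finite_quotient_of_isRelPrime`).
-/

namespace PlaneCurve

/-! ### The derivative lies in the conductor: polynomials in one variable -/

section UnivariateConductor
open Polynomial

/-- Gauss's lemma for a monic polynomial: having no common factor over `R` implies being coprime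
over the fraction field. -/
theorem isCoprime_map_of_isRelPrime {R : Type*} [CommRing R] [IsIntegrallyClosed R]
    (K : Type*) [Field K] [Algebra R K] [IsFractionRing R K]
    {f g : R[X]} (hf : f.Monic) (h : IsRelPrime f g) :
    IsCoprime (f.map (algebraMap R K)) (g.map (algebraMap R K)) := by
  have hinj : Function.Injective (algebraMap R K) := IsFractionRing.injective R K
  refine isCoprime_of_irreducible_dvd (fun h0 => (hf.map _).ne_zero h0.1) fun p hp hpf hpg => ?_
  obtain ⟨q, hq⟩ := IsIntegrallyClosed.eq_map_mul_C_of_dvd K hf hpf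
  have hlc : p.leadingCoeff ≠ 0 := leadingCoeff_ne_zero.2 hp.ne_zero
  have hq' : q.map (algebraMap R K) = p * C p.leadingCoeff⁻¹ := by
    nth_rw 1 [← hq]
    rw [mul_assoc, ← C_mul, mul_inv_cancel₀ hlc, C_1, mul_one]
  have hqm : q.Monic := by
    refine hinj.monic_map_iff.2 ?_
    rw [hq']
    exact monic_mul_leadingCoeff_inv hp.ne_zero
  have hqp : q.map (algebraMap R K) ∣ p := ⟨C p.leadingCoeff, hq.symm⟩
  have hu := h ((map_dvd_map _ hinj hqm).1 (hqp.trans hpf))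
    ((map_dvd_map _ hinj hqm).1 (hqp.trans hpg))
  refine hp.not_isUnit ?_
  rw [← hq]
  exact (hu.map (mapRingHom (algebraMap R K))).mul (isUnit_C.2 hlc.isUnit)

/-- The derivative of a separable monic polynomial `f` over an integrally closed domain `R` lies in
the conductor of `R[X] ⧸ f`: if the fraction `E * N / M`, where `E` is the leading coefficient of
`p`, is integral over `R[X] ⧸ f` because `N / M` is a root of `p`, then its product with `f'` lies
in `R[X] ⧸ f`. The equation of `N / M` need only hold after multiplication by some `T` prime to `f`.
Indeed, if `z` runs over the values of the fraction at the roots `α` of `f`, which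
are integral over `R`, then the polynomial `∑ z * f / (X - α)` takes the value `z * f'(α)` at `α`.
It is defined over the fraction field of `R`, and its coefficients are integral over `R`. -/
theorem exists_dvd_derivative_mul_sub {R : Type*} [CommRing R] [IsDomain R] [IsIntegrallyClosed R]
    (K L : Type*) [Field K] [Algebra R K] [IsFractionRing R K] [Field L] [Algebra K L] [Algebra R L]
    [IsScalarTower R K L] [IsAlgClosed L] {f M N T : R[X]} (hf : f.Monic)
    (hsep : IsRelPrime f (derivative f)) (hM : IsRelPrime f M) (hT : IsRelPrime f T) (p : R[X][X])
    (hp : f ∣ T * ∑ i ∈ Finset.range (p.natDegree + 1),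
      p.coeff i * N ^ i * M ^ (p.natDegree - i)) :
    ∃ Q : R[X], f ∣ derivative f * (p.leadingCoeff * N) - M * Q := by
  classical
  have hinjK : Function.Injective (algebraMap R K) := IsFractionRing.injective R K
  have hinjL : Function.Injective (algebraMap R L) := by
    rw [IsScalarTower.algebraMap_eq R K L]
    exact (algebraMap K L).injective.comp hinjK
  have hne : ∀ {α : L} {g : R[X]}, IsRelPrime f g → aeval α f = 0 → aeval α g ≠ 0 := by
    intro α g hg hα h0
    obtain ⟨u, w, huw⟩ := isCoprime_map_of_isRelPrime K hf hg
    have := congrArg (aeval α) huw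
    rw [map_add, map_mul, map_mul, aeval_map_algebraMap, aeval_map_algebraMap, hα, h0] at this
    simp at this
  set E := p.leadingCoeff
  let z : L → L := fun α => aeval α E * (aeval α N / aeval α M)
  have hint : ∀ α : L, aeval α f = 0 → IsIntegral R α := fun α hα => ⟨f, hf, hα⟩
  -- The values of the fraction at the roots of `f` are integral.
  have hz : ∀ α : L, aeval α f = 0 → IsIntegral R (z α) := by
    intro α hα
    let B := integralClosure R L
    let φ : R[X] →+* B := (aeval (⟨α, hint α hα⟩ : B)).toRingHom
    have hφ : (algebraMap B L).comp φ = (aeval α).toRingHom := by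
      ext x
      · simp [φ, ← IsScalarTower.algebraMap_apply]
      · simp [φ]
    have hMα := hne hM hα
    have h1 : p.eval₂ (aeval α).toRingHom (aeval α N / aeval α M) = 0 := by
      obtain ⟨w, hw⟩ := hp
      have h2 := congrArg (aeval α) hw
      rw [map_mul, map_mul, hα, zero_mul] at h2
      have h3 := (mul_eq_zero.1 h2).resolve_left (hne hT hα)
      rw [eval₂_eq_sum_range]
      rw [map_sum] at h3
      have h4 : (∑ i ∈ Finset.range (p.natDegree + 1),
          aeval α (p.coeff i) * (aeval α N / aeval α M) ^ i) * aeval α M ^ p.natDegree = 0 := by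
        rw [Finset.sum_mul, ← h3]
        refine Finset.sum_congr rfl fun i hi => ?_
        have hi' : i ≤ p.natDegree := by
          have := Finset.mem_range.1 hi
          omega
        rw [map_mul, map_mul, map_pow, map_pow, div_pow, mul_assoc, mul_assoc]
        congr 1
        obtain ⟨j, hj⟩ := Nat.exists_eq_add_of_le hi'
        rw [hj, Nat.add_sub_cancel_left, pow_add]
        field_simp
      exact (mul_eq_zero.1 h4).resolve_right (pow_ne_zero _ hMα)
    have h2 := RingHom.isIntegralElem_leadingCoeff_mul (aeval α).toRingHom p _ h1
    rw [← hφ] at h2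
    obtain ⟨q, hq, hq0⟩ := h2
    have h3 : IsIntegral B (z α) := by
      refine ⟨q.map φ, hq.map φ, ?_⟩
      rw [eval₂_map, ← hq0, hφ]
      rfl
    exact isIntegral_trans (R := R) (A := B) _ h3
  -- The polynomial `g` of degree less than `deg f` that represents `f' * E * N / M` modulo `f`.
  set fK := f.map (algebraMap R K)
  have hfK : fK.Monic := hf.map _
  obtain ⟨u, w, huw⟩ := isCoprime_map_of_isRelPrime K hf hM
  set g := ((derivative f * (E * N)).map (algebraMap R K) * w) %ₘ fK
  have hg : fK ∣ (derivative f * (E * N)).map (algebraMap R K) - M.map (algebraMap R K) * g := by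
    have h1 := modByMonic_add_div ((derivative f * (E * N)).map (algebraMap R K) * w) fK
    refine ⟨(derivative f * (E * N)).map (algebraMap R K) * u + M.map (algebraMap R K) *
      (((derivative f * (E * N)).map (algebraMap R K) * w) /ₘ fK), ?_⟩
    change _ - _ * ((derivative f * (E * N)).map (algebraMap R K) * w %ₘ fK) = _
    linear_combination (derivative f * (E * N)).map (algebraMap R K) * (-huw) +
      (-M.map (algebraMap R K)) * h1
  have hdeg : g.degree < fK.degree := degree_modByMonic_lt _ hfK
  set s := (f.aroots L).toFinset
  have hsepK : fK.Separable := by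
    rw [separable_def, derivative_map]
    exact isCoprime_map_of_isRelPrime K hf hsep
  have hroots : (f.aroots L).Nodup := by
    rw [aroots_def, IsScalarTower.algebraMap_eq R K L, ← map_map]
    exact nodup_roots hsepK.map
  have hs : ∀ {α}, α ∈ s → aeval α f = 0 := fun {α} h => by
    rw [Multiset.mem_toFinset, mem_aroots'] at h
    exact h.2
  have hfL : f.map (algebraMap R L) = Lagrange.nodal s id := by
    have h1 : (f.map (algebraMap R L)).Splits := IsAlgClosed.splits _
    conv_lhs => rw [h1.eq_prod_roots_of_monic (hf.map _)]
    rw [Lagrange.nodal, Finset.prod, Multiset.toFinset_val, hroots.dedup]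
    rfl
  let gL : L[X] := ∑ α ∈ s, C (z α) * Lagrange.nodal (s.erase α) id
  have hgL : g.map (algebraMap K L) = gL := by
    have hcard : (s.card : WithBot ℕ) = fK.degree := by
      rw [← Lagrange.degree_nodal (s := s) (v := id), ← hfL, hf.degree_map, hf.degree_map]
    refine eq_of_degrees_lt_of_eval_finset_eq s ?_ ?_ fun α hα => ?_
    · rw [degree_map, hcard]
      exact hdeg
    · refine (degree_sum_le _ _).trans_lt ?_
      rw [Finset.sup_lt_iff (by rw [hcard]; exact bot_le.trans_lt hdeg)]
      intro α hα
      rw [← smul_eq_C_mul]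
      refine (degree_smul_le _ _).trans_lt ?_
      rw [Lagrange.degree_nodal]
      exact_mod_cast Finset.card_erase_lt_of_mem hα
    · have h0 := hs hα
      have h1 : aeval α (derivative f) * (aeval α E * aeval α N) = aeval α M * aeval α g := by
        obtain ⟨y, hy⟩ := hg
        have := congrArg (aeval α) hy
        rw [map_sub, map_mul, map_mul, aeval_map_algebraMap, aeval_map_algebraMap,
          aeval_map_algebraMap, h0, zero_mul, sub_eq_zero, map_mul, map_mul] at this
        exact this
      have h2 : aeval α (derivative f) = eval α (Lagrange.nodal (s.erase α) id) := by
        have h3 := Lagrange.eval_nodal_derivative_eval_node_eq (v := id) hα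
        rw [id] at h3
        rw [← h3, ← hfL, derivative_map]
        simp [aeval_def, eval_map]
      have hMα := hne hM h0
      rw [eval_map_algebraMap, eval_finsetSum, Finset.sum_eq_single α]
      · rw [eval_mul, eval_C, ← h2]
        simp only [z]
        field_simp
        linear_combination -h1
      · intro β hβ hβα
        rw [eval_mul]
        have : eval α (Lagrange.nodal (s.erase β) id) = 0 :=
          Lagrange.eval_nodal_at_node (v := id) (Finset.mem_erase.2 ⟨hβα.symm, hα⟩)
        rw [this, mul_zero]
      · exact fun h => (h hα).elim
  have hlift : g ∈ lifts (algebraMap R K) := by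
    rw [lifts_iff_coeff_lifts]
    intro n
    have h1 : gL ∈ lifts (algebraMap (integralClosure R L) L) := by
      refine sum_mem fun α hα => mul_mem (C_mem_lifts _ (⟨z α, hz α (hs hα)⟩ : integralClosure R L))
        (prod_mem fun β hβ => ?_)
      rw [sub_eq_add_neg, ← C_neg]
      exact add_mem (X_mem_lifts _) (C_mem_lifts _
        (⟨-β, (hint β (hs (Finset.mem_of_mem_erase hβ))).neg⟩ : integralClosure R L))
    obtain ⟨b, hb⟩ := (lifts_iff_coeff_lifts _).1 h1 n
    rw [← hgL, coeff_map] at hb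
    have h2 : IsIntegral R (algebraMap K L (g.coeff n)) := hb ▸ b.2
    rw [isIntegral_algebraMap_iff (algebraMap K L).injective] at h2
    exact IsIntegrallyClosed.isIntegral_iff.1 h2
  obtain ⟨Q, hQ⟩ := (mem_lifts _).1 hlift
  refine ⟨Q, (map_dvd_map _ hinjK hf).1 ?_⟩
  rw [Polynomial.map_sub, Polynomial.map_mul (algebraMap R K) (p := M), hQ]
  exact hg

end UnivariateConductor

/-! ### The normalization of a ring, modulo the ring -/

section Normalization
variable (O : Type*) [CommRing O]

/-- The quotient of the normalization of the ring `O` by `O`, whose dimension is the delta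
invariant. -/
def NormalizationQuotient : Type _ :=
  integralClosure O (FractionRing O) ⧸
    LinearMap.range (Algebra.linearMap O (integralClosure O (FractionRing O)))

noncomputable instance : AddCommGroup (NormalizationQuotient O) :=
  inferInstanceAs (AddCommGroup (integralClosure O (FractionRing O) ⧸
    LinearMap.range (Algebra.linearMap O (integralClosure O (FractionRing O)))))

noncomputable instance (κ : Type*) [CommRing κ] [Algebra κ O] :
    Module κ (NormalizationQuotient O) :=
  inferInstanceAs (Module κ (integralClosure O (FractionRing O) ⧸
    LinearMap.range (Algebra.linearMap O (integralClosure O (FractionRing O)))))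

instance (κ : Type*) [CommRing κ] [Algebra κ O] : IsScalarTower κ O (NormalizationQuotient O) :=
  inferInstanceAs (IsScalarTower κ O (integralClosure O (FractionRing O) ⧸
    LinearMap.range (Algebra.linearMap O (integralClosure O (FractionRing O)))))

/-- The quotient map from the normalization of `O`. -/
noncomputable def NormalizationQuotient.mkQ :
    integralClosure O (FractionRing O) →ₗ[O] NormalizationQuotient O :=
  Submodule.mkQ (LinearMap.range (Algebra.linearMap O (integralClosure O (FractionRing O))))

variable {O} in
theorem NormalizationQuotient.exists_of_mkQ_eq_zero {b : integralClosure O (FractionRing O)}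
    (h : NormalizationQuotient.mkQ O b = 0) : ∃ s : O, algebraMap O (FractionRing O) s = b := by
  obtain ⟨s, hs⟩ := (Submodule.Quotient.mk_eq_zero _).1 h
  exact ⟨s, congrArg Subtype.val hs⟩

theorem deltaInvariant_eq_finrank (κ : Type*) [Field κ] [Algebra κ O] :
    deltaInvariant κ O = Module.finrank κ (NormalizationQuotient O) := rfl

variable {O}

/-- If a nonzerodivisor `c` multiplies the normalization of `O` into `O`, then multiplication by `c`
embeds the quotient of the normalization by `O` into `O ⧸ (c)`. The fractions in the normalization
are written as `p / q`, with an equation of integral dependence whose denominators are cleared. -/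
theorem exists_injective_normalizationQuotient {c : O} (hc : c ∈ nonZeroDivisors O)
    (h : ∀ (p q : O) (n : ℕ) (b : ℕ → O), q ∈ nonZeroDivisors O → b n = 1 →
      ∑ i ∈ Finset.range (n + 1), b i * p ^ i * q ^ (n - i) = 0 → ∃ o, c * p = o * q) :
    ∃ φ : NormalizationQuotient O →ₗ[O] O ⧸ Ideal.span {c}, Function.Injective φ := by
  set B := integralClosure O (FractionRing O)
  have hinjF : Function.Injective (algebraMap O (FractionRing O)) :=
    IsFractionRing.injective O (FractionRing O)
  have hinj : Function.Injective (Algebra.linearMap O B) := fun x y hxy =>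
    hinjF (congrArg Subtype.val hxy)
  set N := LinearMap.range (Algebra.linearMap O B)
  have hcB : ∀ z : B, c • z ∈ N := by
    rintro ⟨z, g, hg, hg0⟩
    obtain ⟨p, q, rfl⟩ := IsLocalization.exists_mk'_eq (nonZeroDivisors O) z
    obtain ⟨o, ho⟩ := h p q g.natDegree (fun i => g.coeff i) q.2 hg (by
      have h1 := scaleRoots_aeval_eq_zero_of_aeval_mk'_eq_zero (p := g) (r := p) (s := q) hg0
      rw [Polynomial.aeval_algebraMap_apply] at h1
      have h2 := hinjF (h1.trans (map_zero _).symm)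
      rw [Polynomial.aeval_eq_sum_range, Polynomial.natDegree_scaleRoots] at h2
      rw [← h2]
      refine Finset.sum_congr rfl fun i _ => ?_
      rw [Polynomial.coeff_scaleRoots, smul_eq_mul]
      ring)
    refine ⟨o, Subtype.ext ?_⟩
    change algebraMap O (FractionRing O) o = c • _
    rw [Algebra.smul_def, IsLocalization.mul_mk'_eq_mk'_of_mul, ho,
      IsLocalization.mk'_mul_cancel_right]
  let m : B →ₗ[O] N := (LinearMap.lsmul O B c).codRestrict N hcB
  let e : O ≃ₗ[O] N := LinearEquiv.ofInjective (Algebra.linearMap O B) hinj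
  let χ : B →ₗ[O] O ⧸ Ideal.span {c} :=
    (Submodule.mkQ (Ideal.span {c})).comp (e.symm.toLinearMap.comp m)
  have hχ : ∀ z : B, χ z = 0 ↔ z ∈ N := by
    intro z
    have h1 : χ z = 0 ↔ e.symm (m z) ∈ Ideal.span {c} := Submodule.Quotient.mk_eq_zero _
    rw [h1, Ideal.mem_span_singleton]
    have hm : ((e (e.symm (m z)) : N) : B) = c • z := by
      rw [e.apply_symm_apply]
      rfl
    have hcu : IsUnit (algebraMap O (FractionRing O) c) :=
      IsLocalization.map_units (FractionRing O) (⟨c, hc⟩ : nonZeroDivisors O)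
    constructor
    · rintro ⟨w, hw⟩
      rw [hw] at hm
      refine ⟨w, Subtype.ext (hcu.mul_left_cancel ?_)⟩
      have := congrArg Subtype.val hm
      change algebraMap O (FractionRing O) (c * w) = c • (z : FractionRing O) at this
      rw [map_mul, Algebra.smul_def] at this
      exact this
    · rintro ⟨w, rfl⟩
      refine ⟨w, hinj ?_⟩
      rw [← smul_eq_mul, map_smul]
      exact hm
  have hle : N ≤ LinearMap.ker χ := fun z hz => LinearMap.mem_ker.2 ((hχ z).2 hz)
  exact ⟨N.liftQ χ hle, LinearMap.ker_eq_bot.1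
    (Submodule.ker_liftQ_eq_bot _ _ hle fun z hz => (hχ z).1 (LinearMap.mem_ker.1 hz))⟩

/-- For `x y = 0` with `x + y` a nonzerodivisor, the idempotent `x / (x + y)` lies in the
normalization. Its multiples by elements of `O` detect the ideal `(x, y)`. -/
theorem exists_linearMap_normalizationQuotient {x y : O} (hxy : x * y = 0)
    (hs : x + y ∈ nonZeroDivisors O) :
    ∃ θ : O →ₗ[O] NormalizationQuotient O, ∀ r, θ r = 0 → ∃ s, r * x = s * (x + y) := by
  let e : FractionRing O := IsLocalization.mk' (FractionRing O) x (⟨x + y, hs⟩ : nonZeroDivisors O)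
  have he : e * e = e := by
    rw [← IsLocalization.mk'_mul, IsLocalization.mk'_eq_iff_eq]
    congr 1
    simp only [Submonoid.coe_mul]
    linear_combination (-(x + y)) * hxy
  have hint : IsIntegral O e := by
    refine ⟨Polynomial.X * (Polynomial.X - Polynomial.C 1),
      Polynomial.monic_X.mul (Polynomial.monic_X_sub_C 1), ?_⟩
    rw [Polynomial.eval₂_mul, Polynomial.eval₂_sub, Polynomial.eval₂_X, Polynomial.eval₂_C,
      map_one, mul_sub, he, mul_one, sub_self]
  refine ⟨(NormalizationQuotient.mkQ O).comp (LinearMap.toSpanSingleton O _ ⟨e, hint⟩),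
    fun r hr => ?_⟩
  obtain ⟨s, hs'⟩ := NormalizationQuotient.exists_of_mkQ_eq_zero hr
  have h1 : algebraMap O (FractionRing O) s = r • e := hs'
  refine ⟨s, IsFractionRing.injective O (FractionRing O) ?_⟩
  rw [map_mul, map_mul, h1, Algebra.smul_def, mul_assoc]
  congr 1
  exact (IsLocalization.mk'_spec (FractionRing O) x (⟨x + y, hs⟩ : nonZeroDivisors O)).symm

theorem mk_mem_nonZeroDivisors_iff {R : Type*} [CommRing R] {I : Ideal R} {q : R} :
    Ideal.Quotient.mk I q ∈ nonZeroDivisors (R ⧸ I) ↔ ∀ r, q * r ∈ I → r ∈ I := by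
  rw [mem_nonZeroDivisors_iff_left, Ideal.Quotient.mk_surjective.forall]
  simp only [← map_mul, Ideal.Quotient.eq_zero_iff_mem]

/-- A form of `exists_injective_normalizationQuotient` for a quotient ring `R ⧸ I`, in terms of
representatives in `R`. -/
theorem exists_injective_normalizationQuotient_quotient {R : Type*} [CommRing R] (I : Ideal R)
    {c : R} (hc : ∀ r, c * r ∈ I → r ∈ I)
    (h : ∀ (p q : R) (n : ℕ) (b : ℕ → R), (∀ r, q * r ∈ I → r ∈ I) → b n = 1 →
      ∑ i ∈ Finset.range (n + 1), b i * p ^ i * q ^ (n - i) ∈ I → ∃ o, c * p - o * q ∈ I) :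
    ∃ φ : NormalizationQuotient (R ⧸ I) →ₗ[R ⧸ I] (R ⧸ I) ⧸ Ideal.span {Ideal.Quotient.mk I c},
      Function.Injective φ := by
  classical
  refine exists_injective_normalizationQuotient (mk_mem_nonZeroDivisors_iff.2 hc)
    fun p' q' n b' hq hb hrel => ?_
  obtain ⟨p, rfl⟩ := Ideal.Quotient.mk_surjective p'
  obtain ⟨q, rfl⟩ := Ideal.Quotient.mk_surjective q'
  choose b₀ hb₀ using fun i => Ideal.Quotient.mk_surjective (b' i)
  have hb' : ∀ i, Ideal.Quotient.mk I (Function.update b₀ n 1 i) = b' i := by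
    intro i
    by_cases hi : i = n
    · rw [hi, Function.update_self, map_one, hb]
    · rw [Function.update_of_ne hi, hb₀]
  obtain ⟨o, ho⟩ := h p q n (Function.update b₀ n 1) (mk_mem_nonZeroDivisors_iff.1 hq)
    (Function.update_self _ _ _) (by
      rw [← Ideal.Quotient.eq_zero_iff_mem, map_sum, ← hrel]
      refine Finset.sum_congr rfl fun i _ => ?_
      rw [map_mul, map_mul, map_pow, map_pow, hb'])
  refine ⟨Ideal.Quotient.mk I o, ?_⟩
  rw [← map_mul, ← map_mul]
  exact Ideal.Quotient.eq.2 ho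

/-- The normalization of `R ⧸ I` is finite modulo `R ⧸ I` if the conductor contains the class of a
nonzerodivisor `c` for which `R ⧸ (I, c)` is finite. -/
theorem finite_normalizationQuotient (κ : Type*) [Field κ] {R : Type*} [CommRing R] [Algebra κ R]
    (I : Ideal R) {c : R} (hc : ∀ r, c * r ∈ I → r ∈ I)
    (h : ∀ (p q : R) (n : ℕ) (b : ℕ → R), (∀ r, q * r ∈ I → r ∈ I) → b n = 1 →
      ∑ i ∈ Finset.range (n + 1), b i * p ^ i * q ^ (n - i) ∈ I → ∃ o, c * p - o * q ∈ I)
    [Module.Finite κ (R ⧸ I ⊔ Ideal.span {c})] :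
    Module.Finite κ (NormalizationQuotient (R ⧸ I)) := by
  obtain ⟨φ, hφ⟩ := exists_injective_normalizationQuotient_quotient I hc h
  have hmap : (Ideal.span {c}).map (Ideal.Quotient.mkₐ κ I) =
      Ideal.span {Ideal.Quotient.mk I c} := by
    rw [Ideal.map_span, Set.image_singleton]
    rfl
  have hfin : Module.Finite κ ((R ⧸ I) ⧸ Ideal.span {Ideal.Quotient.mk I c}) := by
    rw [← hmap]
    exact Module.Finite.equiv
      (DoubleQuot.quotQuotEquivQuotSupₐ κ I (Ideal.span {c})).symm.toLinearEquiv
  exact Module.Finite.of_injective (φ.restrictScalars κ) hφ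

theorem deltaInvariant_eq_zero (κ : Type*) [Field κ] {R : Type*} [CommRing R] [Algebra κ R]
    (I : Ideal R) {c : R} (hc : IsUnit c)
    (h : ∀ (p q : R) (n : ℕ) (b : ℕ → R), (∀ r, q * r ∈ I → r ∈ I) → b n = 1 →
      ∑ i ∈ Finset.range (n + 1), b i * p ^ i * q ^ (n - i) ∈ I → ∃ o, c * p - o * q ∈ I) :
    deltaInvariant κ (R ⧸ I) = 0 := by
  obtain ⟨φ, hφ⟩ := exists_injective_normalizationQuotient_quotient I
    (fun r hr => (Ideal.unit_mul_mem_iff_mem I hc).1 hr) h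
  have : Subsingleton ((R ⧸ I) ⧸ Ideal.span {Ideal.Quotient.mk I c}) := by
    rw [Ideal.Quotient.subsingleton_iff, Ideal.span_singleton_eq_top]
    exact hc.map _
  have : Subsingleton (NormalizationQuotient (R ⧸ I)) := hφ.subsingleton
  rw [deltaInvariant_eq_finrank]
  exact Module.finrank_zero_of_subsingleton

/-- A form of `exists_linearMap_normalizationQuotient` for a quotient ring `R ⧸ I`, in terms of
representatives in `R`. -/
theorem exists_linearMap_normalizationQuotient_quotient (κ : Type*) [Field κ] {R : Type*}
    [CommRing R] [Algebra κ R] (I : Ideal R) {x y : R} (hxy : x * y ∈ I)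
    (hs : ∀ r, (x + y) * r ∈ I → r ∈ I) :
    ∃ θ : R →ₗ[κ] NormalizationQuotient (R ⧸ I),
      ∀ r, θ r = 0 → ∃ s, r * x - s * (x + y) ∈ I := by
  obtain ⟨θ, hθ⟩ := exists_linearMap_normalizationQuotient
    (x := Ideal.Quotient.mk I x) (y := Ideal.Quotient.mk I y)
    (by rwa [← map_mul, Ideal.Quotient.eq_zero_iff_mem])
    (by rwa [← map_add, mk_mem_nonZeroDivisors_iff])
  refine ⟨(θ.restrictScalars κ).comp (Ideal.Quotient.mkₐ κ I).toLinearMap, fun r hr => ?_⟩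
  obtain ⟨s', h⟩ := hθ _ hr
  obtain ⟨s, rfl⟩ := Ideal.Quotient.mk_surjective s'
  refine ⟨s, Ideal.Quotient.eq.1 ?_⟩
  rw [map_mul, map_mul, map_add]
  exact h

theorem finite_of_forall_card_le {κ M : Type*} [Field κ] [AddCommGroup M] [Module κ M] (n : ℕ)
    (h : ∀ s : Finset M, (∀ u : s → κ, ∑ x, u x • (x : M) = 0 → ∀ x, u x = 0) → s.card ≤ n) :
    Module.Finite κ M := by
  rw [← Module.rank_lt_aleph0_iff]
  exact (rank_le fun s hs => h s (Fintype.linearIndependent_iff.1 hs)).trans_lt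
    (Cardinal.natCast_lt_aleph0 (n := n))

/-- If the kernel of a linear map `q` contains the common kernel of the linear maps `ψ i`, then its
rank is at most the sum of the dimensions of their codomains. -/
theorem finrank_range_le_sum {κ V W : Type*} [Field κ] [AddCommGroup V] [Module κ V]
    [Module.Finite κ V] [AddCommGroup W] [Module κ W] {ι : Type*} [Fintype ι] {M : ι → Type*}
    [∀ i, AddCommGroup (M i)] [∀ i, Module κ (M i)] [∀ i, Module.Finite κ (M i)]
    (q : V →ₗ[κ] W) (ψ : ∀ i, V →ₗ[κ] M i) (h : ∀ x, (∀ i, ψ i x = 0) → q x = 0) :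
    Module.finrank κ (LinearMap.range q) ≤ ∑ i, Module.finrank κ (M i) := by
  have h1 := q.finrank_range_add_finrank_ker
  have h2 := (LinearMap.pi ψ).finrank_range_add_finrank_ker
  have h3 : LinearMap.ker (LinearMap.pi ψ) ≤ LinearMap.ker q := fun x hx =>
    h x fun i => congrFun hx i
  have h4 := Submodule.finrank_mono h3
  have h5 := Submodule.finrank_le (LinearMap.range (LinearMap.pi ψ))
  rw [Module.finrank_pi_fintype] at h5
  omega

end Normalization

open MvPolynomial

/-! ### Homogeneous polynomials -/

section Homogeneous
variable {σ R : Type*} [CommRing R]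

theorem homogeneousComponent_mul_of_isHomogeneous {A : MvPolynomial σ R} {a : ℕ}
    (hA : A.IsHomogeneous a) (B : MvPolynomial σ R) (n : ℕ) :
    homogeneousComponent (a + n) (A * B) = A * homogeneousComponent n B := by
  classical
  conv_lhs => rw [← sum_homogeneousComponent B, Finset.mul_sum, map_sum]
  have key : ∀ i, homogeneousComponent (a + n) (A * homogeneousComponent i B) =
      if i = n then A * homogeneousComponent n B else 0 := by
    intro i
    rw [homogeneousComponent_of_mem (hA.mul (homogeneousComponent_isHomogeneous i B))]
    by_cases h : i = n
    · simp [h]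
    · simp [h, Ne.symm h]
  simp only [key, Finset.sum_ite_eq', Finset.mem_range]
  split_ifs with h
  · rfl
  · rw [homogeneousComponent_eq_zero _ _ (by omega), mul_zero]

theorem homogeneousComponent_of_isHomogeneous {A : MvPolynomial σ R} {a : ℕ}
    (hA : A.IsHomogeneous a) : homogeneousComponent a A = A := by
  rw [homogeneousComponent_of_mem hA, if_pos rfl]

/-- A factor of a form is a form: the lowest degree of a monomial and the highest one are both
additive on products. The former is the order as a power series. -/
theorem isHomogeneous_of_mul_left [IsDomain R] {A B : MvPolynomial σ R} {n : ℕ}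
    (h : (A * B).IsHomogeneous n) (h0 : A * B ≠ 0) : A.IsHomogeneous A.totalDegree := by
  have hA : A ≠ 0 := left_ne_zero_of_mul h0
  have hB : B ≠ 0 := right_ne_zero_of_mul h0
  have htd := totalDegree_mul_of_isDomain hA hB
  rw [h.totalDegree h0] at htd
  have hle : ∀ {C : MvPolynomial σ R} {m : σ →₀ ℕ}, coeff m C ≠ 0 →
      (C : MvPowerSeries σ R).order ≤ (m.degree : ℕ∞) := fun {C m} hm =>
    MvPowerSeries.order_le (by simpa using hm)
  have hdeg : ∀ {C : MvPolynomial σ R} {m : σ →₀ ℕ}, coeff m C ≠ 0 → m.degree ≤ C.totalDegree :=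
    fun {C m} hm => le_totalDegree (mem_support_iff.2 hm)
  have hge : (n : ℕ∞) ≤ ((A * B : MvPolynomial σ R) : MvPowerSeries σ R).order := by
    refine MvPowerSeries.le_order fun d hd => ?_
    rw [coeff_coe]
    exact h.coeff_eq_zero (by rintro rfl; simp at hd)
  rw [coe_mul, MvPowerSeries.order_mul] at hge
  obtain ⟨mB, hmB⟩ := ne_zero_iff.1 hB
  intro m hm
  have h1 := hle hm
  have h2 := hle hmB
  have h3 := hdeg hm
  have h4 := hdeg hmB
  have h5 : (n : ℕ∞) ≤ (m.degree : ℕ∞) + (mB.degree : ℕ∞) := hge.trans (add_le_add h1 h2)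
  have h6 : n ≤ m.degree + mB.degree := by exact_mod_cast h5
  have : m.degree = A.totalDegree := by omega
  rw [← this, Finsupp.degree_eq_weight_one]
  rfl

theorem isHomogeneous_of_mul_right [IsDomain R] {A B : MvPolynomial σ R} {n : ℕ}
    (h : (A * B).IsHomogeneous n) (h0 : A * B ≠ 0) : B.IsHomogeneous B.totalDegree :=
  isHomogeneous_of_mul_left (mul_comm A B ▸ h) (mul_comm A B ▸ h0)

/-- A form in an ideal generated by two forms is a combination with forms of the right degrees. -/
theorem exists_isHomogeneous_of_mem_span_pair {A B G : MvPolynomial σ R} {a b m n d : ℕ}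
    (hA : A.IsHomogeneous a) (hB : B.IsHomogeneous b) (hG : G.IsHomogeneous d)
    (ha : a + m = d) (hb : b + n = d) (h : G ∈ Ideal.span {A, B}) :
    ∃ U V : MvPolynomial σ R, U.IsHomogeneous m ∧ V.IsHomogeneous n ∧ G = A * U + B * V := by
  obtain ⟨U, V, hUV⟩ := Ideal.mem_span_pair.1 h
  refine ⟨homogeneousComponent m U, homogeneousComponent n V,
    homogeneousComponent_isHomogeneous _ _, homogeneousComponent_isHomogeneous _ _, ?_⟩
  rw [← homogeneousComponent_mul_of_isHomogeneous hA, ha,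
    ← homogeneousComponent_mul_of_isHomogeneous hB, hb, ← map_add, mul_comm A, mul_comm B, hUV,
    homogeneousComponent_of_isHomogeneous hG]

theorem eval_smul_of_isHomogeneous {A : MvPolynomial σ R} {a : ℕ} (hA : A.IsHomogeneous a)
    (c : R) (x : σ → R) : eval (c • x) A = c ^ a * eval x A := by
  rw [eval_eq, eval_eq, Finset.mul_sum]
  refine Finset.sum_congr rfl fun m hm => ?_
  have : ∑ i ∈ m.support, m i = a := by
    rw [← hA (mem_support_iff.1 hm), Pi.one_def, ← Finsupp.degree_eq_weight_one]
    rfl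
  simp only [Pi.smul_apply, smul_eq_mul, mul_pow, Finset.prod_mul_distrib,
    Finset.prod_pow_eq_pow_sum, this]
  ring

end Homogeneous

/-! ### The Hilbert function of two forms without common factor -/

section Hilbert
variable {Ω : Type*} [Field Ω]

theorem finrank_homogeneousSubmodule (d : ℕ) :
    Module.finrank Ω (homogeneousSubmodule (Fin 3) Ω d) = (d + 2).choose 2 := by
  classical
  rw [homogeneousSubmodule_eq_finsupp_supported]
  have hs : {m : Fin 3 →₀ ℕ | m.degree = d} =
      ((Finset.univ : Finset (Fin 3)).finsuppAntidiag d : Set (Fin 3 →₀ ℕ)) := by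
    ext m
    simp [Finset.mem_finsuppAntidiag, Finsupp.degree_eq_sum]
  rw [hs, (AddMonoidAlgebra.supportedEquivFinsupp _).finrank_eq, Module.finrank_finsupp_self]
  simp only [Finset.coe_sort_coe, Fintype.card_coe, Finset.card_finsuppAntidiag_nat_eq_choose]
  simp only [Finset.card_univ, Fintype.card_fin]
  rw [show 3 + d - 1 = d + 2 by omega, Nat.choose_symm_add]

instance (d : ℕ) : Module.Finite Ω (homogeneousSubmodule (Fin 3) Ω d) :=
  Module.Finite.iff_fg.2 (homogeneousSubmodule_fg (Fin 3) Ω d)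

/-- The degree `d` part of the quotient of `Ω[X₀, X₁, X₂]` by a (homogeneous) ideal `I`: the
subspace of residue classes of forms of degree `d`. -/
noncomputable def formsMod (I : Ideal (MvPolynomial (Fin 3) Ω)) (d : ℕ) :
    Submodule Ω (MvPolynomial (Fin 3) Ω ⧸ I) :=
  (homogeneousSubmodule (Fin 3) Ω d).map (Ideal.Quotient.mkₐ Ω I).toLinearMap

instance (I : Ideal (MvPolynomial (Fin 3) Ω)) (d : ℕ) : Module.Finite Ω (formsMod I d) :=
  inferInstanceAs (Module.Finite Ω (Submodule.map _ _))

theorem finrank_map_mulLeft {A : MvPolynomial (Fin 3) Ω} (hA : A ≠ 0) (d : ℕ) :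
    Module.finrank Ω ((homogeneousSubmodule (Fin 3) Ω d).map (LinearMap.mulLeft Ω A)) =
      (d + 2).choose 2 := by
  rw [← finrank_homogeneousSubmodule (Ω := Ω) d]
  exact (Submodule.equivMapOfInjective _ (fun x y h => mul_left_cancel₀ hA h) _).finrank_eq.symm

/-- The Hilbert function of a complete intersection of two forms of degrees `a` and `b` is
eventually equal to `a * b`: by the Koszul relations, the part of degree `a + b + m` of the ideal
is a sum of two subspaces whose intersection consists of the multiples of `A * B`. -/
theorem finrank_formsMod {A B : MvPolynomial (Fin 3) Ω} {a b : ℕ} (hA : A.IsHomogeneous a)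
    (hB : B.IsHomogeneous b) (hA0 : A ≠ 0) (hB0 : B ≠ 0) (hAB : IsRelPrime A B) (m : ℕ) :
    Module.finrank Ω (formsMod (Ideal.span {A, B}) (a + b + m)) = a * b := by
  set V := homogeneousSubmodule (Fin 3) Ω (a + b + m)
  set q := (Ideal.Quotient.mkₐ Ω (Ideal.span {A, B})).toLinearMap
  set W₁ := (homogeneousSubmodule (Fin 3) Ω (b + m)).map (LinearMap.mulLeft Ω A)
  set W₂ := (homogeneousSubmodule (Fin 3) Ω (a + m)).map (LinearMap.mulLeft Ω B)
  have hker : (LinearMap.ker (q.comp V.subtype)).map V.subtype = W₁ ⊔ W₂ := by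
    ext G
    simp only [Submodule.mem_map, LinearMap.mem_ker, LinearMap.comp_apply, Submodule.mem_sup,
      Submodule.subtype_apply]
    constructor
    · rintro ⟨G, hG, rfl⟩
      have hG' : (G : MvPolynomial (Fin 3) Ω) ∈ Ideal.span {A, B} :=
        Ideal.Quotient.eq_zero_iff_mem.1 hG
      obtain ⟨U, T, hU, hT, h⟩ := exists_isHomogeneous_of_mem_span_pair hA hB
        (show (G : MvPolynomial (Fin 3) Ω).IsHomogeneous (a + b + m) from G.2)
        (m := b + m) (n := a + m) (by ring) (by ring) hG'
      exact ⟨A * U, ⟨U, hU, rfl⟩, B * T, ⟨T, hT, rfl⟩, h.symm⟩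
    · rintro ⟨_, ⟨U, hU, rfl⟩, _, ⟨T, hT, rfl⟩, rfl⟩
      have h1 : (A * U).IsHomogeneous (a + b + m) := by
        rw [add_assoc]; exact hA.mul hU
      have h2 : (B * T).IsHomogeneous (a + b + m) := by
        rw [add_comm a b, add_assoc]; exact hB.mul hT
      refine ⟨⟨A * U + B * T, h1.add h2⟩, ?_, rfl⟩
      refine Ideal.Quotient.eq_zero_iff_mem.2 (Ideal.mem_span_pair.2 ⟨U, T, ?_⟩)
      change _ = A * U + B * T
      ring
  have hinf : W₁ ⊓ W₂ =
      (homogeneousSubmodule (Fin 3) Ω m).map (LinearMap.mulLeft Ω (A * B)) := by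
    ext G
    simp only [Submodule.mem_inf, Submodule.mem_map, W₁, W₂, LinearMap.mulLeft_apply,
      mem_homogeneousSubmodule]
    constructor
    · rintro ⟨⟨U, hU, rfl⟩, T, hT, h⟩
      obtain ⟨C, rfl⟩ := hAB.symm.dvd_of_dvd_mul_left ⟨T, h.symm⟩
      refine ⟨homogeneousComponent m C, homogeneousComponent_isHomogeneous _ _, ?_⟩
      rw [mul_assoc, ← homogeneousComponent_mul_of_isHomogeneous hB,
        homogeneousComponent_of_isHomogeneous hU]
    · rintro ⟨C, hC, rfl⟩
      exact ⟨⟨B * C, hB.mul hC, by ring⟩, A * C, hA.mul hC, by ring⟩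
  have h1 : Module.finrank Ω (LinearMap.ker (q.comp V.subtype)) =
      Module.finrank Ω (W₁ ⊔ W₂ : Submodule Ω (MvPolynomial (Fin 3) Ω)) := by
    rw [← hker, Submodule.finrank_map_subtype_eq]
  have h2 := (q.comp V.subtype).finrank_range_add_finrank_ker
  have h3 := Submodule.finrank_sup_add_finrank_inf_eq W₁ W₂
  rw [LinearMap.range_comp, Submodule.range_subtype, h1, finrank_homogeneousSubmodule] at h2
  rw [hinf, finrank_map_mulLeft hA0, finrank_map_mulLeft hB0,
    finrank_map_mulLeft (mul_ne_zero hA0 hB0)] at h3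
  change Module.finrank Ω (formsMod (Ideal.span {A, B}) (a + b + m)) + _ = _ at h2
  have ch : ∀ n : ℕ, 2 * (n + 2).choose 2 = (n + 2) * (n + 1) := fun n => by
    rw [Nat.choose_two_right, Nat.mul_div_cancel' (Nat.even_mul_pred_self _).two_dvd]
    rfl
  have c1 := ch (a + b + m)
  have c2 := ch (b + m)
  have c3 := ch (a + m)
  have c4 := ch m
  nlinarith

end Hilbert

/-! ### Common zeros of two forms, and Max Noether's theorem in large degrees -/

section Points
variable {Ω : Type*} [Field Ω]

/-- The linear form with coefficient vector `c`. -/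
noncomputable def linForm (c : Fin 3 → Ω) : MvPolynomial (Fin 3) Ω := ∑ i, C (c i) * X i

theorem linForm_isHomogeneous (c : Fin 3 → Ω) : (linForm c).IsHomogeneous 1 :=
  IsHomogeneous.sum _ _ _ fun i _ => isHomogeneous_C_mul_X (c i) i

theorem eval_linForm (c x : Fin 3 → Ω) : eval x (linForm c) = ∑ i, c i * x i := by
  simp [linForm]

/-- A hyperplane through a subspace that avoids a point outside it. -/
theorem exists_linForm_of_notMem {p : Submodule Ω (Fin 3 → Ω)} {x : Fin 3 → Ω} (hx : x ∉ p) :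
    ∃ c, eval x (linForm c) ≠ 0 ∧ ∀ y ∈ p, eval y (linForm c) = 0 := by
  obtain ⟨f, hf, hp⟩ := Submodule.exists_le_ker_of_notMem hx
  have h : ∀ y, eval y (linForm fun i => f (Pi.single i 1)) = f y := fun y => by
    rw [eval_linForm, LinearMap.pi_apply_eq_sum_univ f y]
    refine Finset.sum_congr rfl fun i _ => ?_
    rw [smul_eq_mul, mul_comm]
    congr 3
    ext j
    simp [Pi.single_apply, eq_comm]
  exact ⟨_, by rwa [h], fun y hy => by rw [h]; exact hp hy⟩

theorem exists_linForm_ne_zero {x : Fin 3 → Ω} (hx : x ≠ 0) : ∃ c, eval x (linForm c) ≠ 0 :=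
  let ⟨c, hc, _⟩ := exists_linForm_of_notMem (p := ⊥) (x := x) (by simpa using hx)
  ⟨c, hc⟩

theorem rep_notMem_span {P Q : ℙ Ω (Fin 3 → Ω)} (h : P ≠ Q) : P.rep ∉ Ω ∙ Q.rep := by
  intro hm
  obtain ⟨a, ha⟩ := Submodule.mem_span_singleton.1 hm
  apply h
  rw [← P.mk_rep, ← Q.mk_rep, Projectivization.mk_eq_mk_iff']
  exact ⟨a, ha⟩

theorem exists_eval_ne_zero [Infinite Ω] {σ : Type*} {p : MvPolynomial σ Ω} (hp : p ≠ 0) :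
    ∃ x, eval x p ≠ 0 := by
  by_contra! h
  exact hp (MvPolynomial.funext fun x => by rw [h, map_zero])

/-- A line that misses finitely many given points. -/
theorem exists_linForm_forall_ne_zero [Infinite Ω] (T : Finset (ℙ Ω (Fin 3 → Ω))) :
    ∃ c, ∀ P ∈ T, eval P.rep (linForm c) ≠ 0 := by
  have hne : ∏ P ∈ T, linForm P.rep ≠ 0 := by
    refine Finset.prod_ne_zero_iff.2 fun P _ h => ?_
    obtain ⟨c, hc⟩ := exists_linForm_ne_zero P.rep_nonzero
    apply hc
    rw [eval_linForm]
    simp_rw [mul_comm (c _)]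
    rw [← eval_linForm, h, map_zero]
  obtain ⟨c, hc⟩ := exists_eval_ne_zero hne
  refine ⟨c, fun P hP => ?_⟩
  rw [map_prod] at hc
  have := Finset.prod_ne_zero_iff.1 hc P hP
  rw [eval_linForm] at this ⊢
  simpa only [mul_comm] using this

/-- Forms separating a point of a finite set from the others, of any degree that is large enough. -/
theorem exists_separating_form (T : Finset (ℙ Ω (Fin 3 → Ω))) (P : ℙ Ω (Fin 3 → Ω)) (N : ℕ) :
    ∃ G : MvPolynomial (Fin 3) Ω, G.IsHomogeneous (T.card + N) ∧ eval P.rep G ≠ 0 ∧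
      ∀ Q ∈ T, Q ≠ P → eval Q.rep G = 0 := by
  classical
  have h : ∀ Q : ℙ Ω (Fin 3 → Ω), ∃ c : Fin 3 → Ω, eval P.rep (linForm c) ≠ 0 ∧
      (Q ≠ P → eval Q.rep (linForm c) = 0) := by
    intro Q
    by_cases hQ : Q = P
    · obtain ⟨c, hc⟩ := exists_linForm_ne_zero P.rep_nonzero
      exact ⟨c, hc, fun h => (h hQ).elim⟩
    · obtain ⟨c, hc, h⟩ := exists_linForm_of_notMem (rep_notMem_span (Ne.symm hQ))
      exact ⟨c, hc, fun _ => h _ (Submodule.mem_span_singleton_self _)⟩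
  choose c hc hc' using h
  refine ⟨(∏ Q ∈ T, linForm (c Q)) * linForm (c P) ^ N, ?_, ?_, fun Q hQ hQP => ?_⟩
  · refine IsHomogeneous.mul ?_ (by simpa using (linForm_isHomogeneous (c P)).pow N)
    simpa using IsHomogeneous.prod T (fun Q => linForm (c Q)) (fun _ => 1)
      (fun Q _ => linForm_isHomogeneous _)
  · rw [map_mul, map_pow, map_prod]
    exact mul_ne_zero (Finset.prod_ne_zero_iff.2 fun Q _ => hc Q) (pow_ne_zero _ (hc P))
  · rw [map_mul, map_prod, Finset.prod_eq_zero hQ (hc' Q hQP), zero_mul]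

theorem mk_mem_formsMod (I : Ideal (MvPolynomial (Fin 3) Ω)) {G : MvPolynomial (Fin 3) Ω} {d : ℕ}
    (hG : G.IsHomogeneous d) : Ideal.Quotient.mk I G ∈ formsMod I d :=
  ⟨G, hG, rfl⟩

/-- Two plane curves without common component meet in finitely many points: otherwise, forms
separating the points would be independent modulo the ideal of the two curves, in a degree where
there are too many of them. -/
theorem finite_setOf_eval_eq_zero {A B : MvPolynomial (Fin 3) Ω} {a b : ℕ} (hA : A.IsHomogeneous a)
    (hB : B.IsHomogeneous b) (hA0 : A ≠ 0) (hB0 : B ≠ 0) (hAB : IsRelPrime A B) :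
    {P : ℙ Ω (Fin 3 → Ω) | eval P.rep A = 0 ∧ eval P.rep B = 0}.Finite := by
  by_contra hinf
  obtain ⟨T, hT, hcard⟩ := Set.Infinite.exists_subset_card_eq hinf (a * b + 1)
  choose G hG hGP hGQ using fun P => exists_separating_form T P (a + b)
  set I := Ideal.span {A, B}
  have hI : ∀ P ∈ T, ∀ p ∈ I, eval P.rep p = 0 := by
    intro P hP p hp
    obtain ⟨u, w, rfl⟩ := Ideal.mem_span_pair.1 hp
    rw [map_add, map_mul, map_mul, (hT hP).1, (hT hP).2, mul_zero, mul_zero, add_zero]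
  let g : T → formsMod I (T.card + (a + b)) := fun P => ⟨_, mk_mem_formsMod I (hG P)⟩
  have hli : LinearIndependent Ω g := by
    rw [Fintype.linearIndependent_iff]
    intro s hs Q
    have h1 : ∑ P, s P • G P ∈ I := by
      rw [← Ideal.Quotient.eq_zero_iff_mem, ← Ideal.Quotient.mkₐ_eq_mk Ω, map_sum]
      have := congrArg Subtype.val hs
      rw [AddSubmonoidClass.coe_finsetSum] at this
      simpa [g] using this
    have h2 := hI Q Q.2 _ h1
    rw [map_sum, Finset.sum_eq_single Q] at h2
    · rw [smul_eval] at h2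
      exact (mul_eq_zero.1 h2).resolve_right (hGP Q)
    · intro P _ hPQ
      rw [smul_eval, hGQ P Q Q.2 (fun h => hPQ (Subtype.ext h.symm)), mul_zero]
    · simp
  have h3 := hli.fintype_card_le_finrank
  rw [show T.card + (a + b) = a + b + T.card by ring, finrank_formsMod hA hB hA0 hB0 hAB,
    Fintype.card_coe, hcard] at h3
  omega

/-- The projective Nullstellensatz, for an ideal whose forms have no common zero. -/
theorem exists_pow_mem_of_forall_ne_zero [IsAlgClosed Ω] {J : Ideal (MvPolynomial (Fin 3) Ω)}
    (hJ : ∀ P : ℙ Ω (Fin 3 → Ω), ∃ p ∈ J, (∃ d, p.IsHomogeneous d) ∧ eval P.rep p ≠ 0)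
    {q : MvPolynomial (Fin 3) Ω} (hq : eval 0 q = 0) : ∃ n : ℕ, q ^ n ∈ J := by
  change q ∈ J.radical
  rw [← vanishingIdeal_zeroLocus_eq_radical (K := Ω), mem_vanishingIdeal_iff]
  intro x hx
  rw [mem_zeroLocus_iff] at hx
  by_cases h0 : x = 0
  · simpa [h0, aeval_eq_eval] using hq
  · obtain ⟨p, hp, ⟨d, hd⟩, hne⟩ := hJ (Projectivization.mk Ω x h0)
    obtain ⟨c, hc⟩ := Projectivization.exists_smul_eq_mk_rep Ω x h0
    refine (hne ?_).elim
    rw [← hc, Units.smul_def, eval_smul_of_isHomogeneous hd]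
    have := hx p hp
    rw [aeval_eq_eval] at this
    rw [this, mul_zero]

/-- Forms of large degree lie in every ideal without zeros in the projective plane. -/
theorem exists_forall_isHomogeneous_mem [IsAlgClosed Ω] {J : Ideal (MvPolynomial (Fin 3) Ω)}
    (hJ : ∀ P : ℙ Ω (Fin 3 → Ω), ∃ p ∈ J, (∃ d, p.IsHomogeneous d) ∧ eval P.rep p ≠ 0) :
    ∃ n : ℕ, ∀ d ≥ n, ∀ G : MvPolynomial (Fin 3) Ω, G.IsHomogeneous d → G ∈ J := by
  have hle : Ideal.span (Set.range (X : Fin 3 → MvPolynomial (Fin 3) Ω)) ≤ J.radical := by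
    rw [Ideal.span_le]
    rintro _ ⟨i, rfl⟩
    exact exists_pow_mem_of_forall_ne_zero hJ (by simp)
  obtain ⟨n, hn⟩ := Ideal.exists_pow_le_of_le_radical_of_fg hle (IsNoetherian.noetherian _)
  refine ⟨n, fun d hd G hG => hn (Ideal.pow_le_pow_right hd ?_)⟩
  rw [Ideal.mem_span_pow_iff_exists_isHomogeneous]
  exact ⟨map C G, hG.map C, by rw [eval_map, eval₂_eta]⟩

/-- Max Noether's theorem in large degrees: a form that lies locally at every common zero in the
ideal `I` of two forms without common factor lies in `I`. For a line `l` missing the common zeros,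
multiplication by `l` is surjective between graded parts of `Ω[X₀, X₁, X₂] / I` in large degrees, by
the Nullstellensatz, hence injective since they all have the same dimension; and a power of `l`
multiplies the form into `I`, again by the Nullstellensatz. -/
theorem mem_span_pair_of_forall_local [IsAlgClosed Ω] {A B : MvPolynomial (Fin 3) Ω} {a b : ℕ}
    (hA : A.IsHomogeneous a) (hB : B.IsHomogeneous b) (hA0 : A ≠ 0) (hB0 : B ≠ 0)
    (hAB : IsRelPrime A B) :
    ∃ n : ℕ, ∀ d ≥ n, ∀ G : MvPolynomial (Fin 3) Ω, G.IsHomogeneous d →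
      (∀ P : ℙ Ω (Fin 3 → Ω), eval P.rep A = 0 → eval P.rep B = 0 →
        ∃ (e : ℕ) (D : MvPolynomial (Fin 3) Ω), D.IsHomogeneous e ∧ eval P.rep D ≠ 0 ∧
          D * G ∈ Ideal.span {A, B}) →
      G ∈ Ideal.span {A, B} := by
  have : Infinite Ω := IsAlgClosed.instInfinite
  have hfin := finite_setOf_eval_eq_zero hA hB hA0 hB0 hAB
  obtain ⟨c, hc⟩ := exists_linForm_forall_ne_zero hfin.toFinset
  simp only [Set.Finite.mem_toFinset, Set.mem_ofPred_eq] at hc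
  set l := linForm c
  have hl : l.IsHomogeneous 1 := linForm_isHomogeneous c
  set I := Ideal.span {A, B}
  have hAI : A ∈ I := Ideal.subset_span (by simp)
  have hBI : B ∈ I := Ideal.subset_span (by simp)
  -- A homogeneous ideal containing `I` has no zeros as soon as it has none among those of `I`.
  have hnozero : ∀ J : Ideal (MvPolynomial (Fin 3) Ω), I ≤ J →
      (∀ P : ℙ Ω (Fin 3 → Ω), eval P.rep A = 0 → eval P.rep B = 0 →
        ∃ p ∈ J, (∃ d, p.IsHomogeneous d) ∧ eval P.rep p ≠ 0) →
      ∀ P : ℙ Ω (Fin 3 → Ω), ∃ p ∈ J, (∃ d, p.IsHomogeneous d) ∧ eval P.rep p ≠ 0 := by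
    intro J hIJ h P
    by_cases h1 : eval P.rep A = 0
    · by_cases h2 : eval P.rep B = 0
      · exact h P h1 h2
      · exact ⟨B, hIJ hBI, ⟨b, hB⟩, h2⟩
    · exact ⟨A, hIJ hAI, ⟨a, hA⟩, h1⟩
  obtain ⟨n, hn⟩ := exists_forall_isHomogeneous_mem (J := I ⊔ Ideal.span {l})
    (hnozero _ le_sup_left fun P h1 h2 =>
      ⟨l, Ideal.mem_sup_right (Ideal.mem_span_singleton_self l), ⟨1, hl⟩, hc P ⟨h1, h2⟩⟩)
  have hhom : ∀ (d : ℕ) (p : MvPolynomial (Fin 3) Ω), p ∈ I → homogeneousComponent d p ∈ I := by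
    intro d p hp
    let _ := gradedAlgebra (σ := Fin 3) (R := Ω)
    have hI : I.IsHomogeneous (homogeneousSubmodule (Fin 3) Ω) := by
      refine Ideal.homogeneous_span _ _ ?_
      rintro x (rfl | rfl)
      · exact ⟨a, hA⟩
      · exact ⟨b, hB⟩
    exact homogeneousComponent_mem_of_mem hI hp d
  -- Multiplication by `l` is injective on forms of large degree modulo `I`.
  have hinj : ∀ m ≥ n, ∀ G : MvPolynomial (Fin 3) Ω, G.IsHomogeneous (a + b + m) →
      l * G ∈ I → G ∈ I := by
    intro m hm G hG hlG
    let μ := LinearMap.mulLeft Ω (Ideal.Quotient.mk I l)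
    have hmap : (formsMod I (a + b + m)).map μ = formsMod I (a + b + (m + 1)) := by
      apply le_antisymm
      · rintro _ ⟨_, ⟨E, hE, rfl⟩, rfl⟩
        refine ⟨l * E, ?_, map_mul (Ideal.Quotient.mk I) l E⟩
        have := hl.mul hE
        rwa [show 1 + (a + b + m) = a + b + (m + 1) by ring] at this
      · rintro _ ⟨E, hE, rfl⟩
        obtain ⟨y, hy, z, hz, hyz⟩ := Submodule.mem_sup.1 (hn _ (by omega) E hE)
        obtain ⟨w, rfl⟩ := Ideal.mem_span_singleton'.1 hz
        refine ⟨Ideal.Quotient.mk I (homogeneousComponent (a + b + m) w),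
          mk_mem_formsMod I (homogeneousComponent_isHomogeneous _ _), ?_⟩
        change Ideal.Quotient.mk I l * _ = Ideal.Quotient.mk I E
        rw [← map_mul, ← homogeneousComponent_mul_of_isHomogeneous hl, Ideal.Quotient.eq,
          show 1 + (a + b + m) = a + b + (m + 1) by ring]
        have h1 := homogeneousComponent_of_isHomogeneous hE
        rw [← hyz, map_add, mul_comm w] at h1
        rw [← hyz, mul_comm w]
        rw [← h1, mul_comm l w, ← neg_mem_iff]
        convert! hhom (a + b + (m + 1)) y hy using 1
        rw [mul_comm w l]
        ring
    have hfr : Module.finrank Ω (LinearMap.range (μ.domRestrict (formsMod I (a + b + m)))) =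
        Module.finrank Ω (formsMod I (a + b + m)) := by
      rw [LinearMap.range_domRestrict, hmap, finrank_formsMod hA hB hA0 hB0 hAB,
        finrank_formsMod hA hB hA0 hB0 hAB]
    have h2 := (μ.domRestrict (formsMod I (a + b + m))).finrank_range_add_finrank_ker
    rw [hfr] at h2
    have h3 : LinearMap.ker (μ.domRestrict (formsMod I (a + b + m))) = ⊥ :=
      Submodule.finrank_eq_zero.1 (by omega)
    have h4 := LinearMap.ker_eq_bot'.1 h3 ⟨_, mk_mem_formsMod I hG⟩
      (by
        change Ideal.Quotient.mk I l * Ideal.Quotient.mk I G = 0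
        rw [← map_mul]
        exact Ideal.Quotient.eq_zero_iff_mem.2 hlG)
    exact Ideal.Quotient.eq_zero_iff_mem.1 (congrArg Subtype.val h4)
  have hpow : ∀ k m : ℕ, m ≥ n → ∀ G : MvPolynomial (Fin 3) Ω, G.IsHomogeneous (a + b + m) →
      l ^ k * G ∈ I → G ∈ I := by
    intro k
    induction k with
    | zero => intro m _ G _ h; simpa using h
    | succ k ih =>
      intro m hm G hG h
      refine hinj m hm G hG (ih (m + 1) (by omega) (l * G) ?_ ?_)
      · have := hl.mul hG
        rwa [show 1 + (a + b + m) = a + b + (m + 1) by ring] at this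
      · rwa [← mul_assoc, ← pow_succ]
  refine ⟨a + b + n, fun d hd G hG hloc => ?_⟩
  obtain ⟨m, rfl⟩ := Nat.exists_eq_add_of_le (show a + b ≤ d by omega)
  obtain ⟨k, hk⟩ := exists_pow_mem_of_forall_ne_zero (J := Submodule.colon I {G}) (q := l)
    (hnozero _ (fun x hx => Submodule.mem_colon_singleton.2 (I.mul_mem_right G hx))
      fun P h1 h2 => by
      obtain ⟨e, D, hD, hne, hmem⟩ := hloc P h1 h2
      exact ⟨D, Submodule.mem_colon_singleton.2 hmem, ⟨e, hD⟩, hne⟩)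
    (by rw [eval_linForm]; simp)
  exact hpow k m (by omega) G hG (Submodule.mem_colon_singleton.1 hk)

end Points

/-! ### Directional derivatives of squarefree forms -/

section Derivative
variable {Ω : Type*} [Field Ω]

/-- Over an algebraically closed field, an irreducible polynomial has a nonzero partial derivative:
otherwise it is constant, or the characteristic is `p > 0` and it is a `p`-th power. -/
theorem exists_pderiv_ne_zero [IsAlgClosed Ω] {σ : Type*} {G : MvPolynomial σ Ω}
    (hG : Irreducible G) : ∃ i, pderiv i G ≠ 0 := by
  classical
  by_contra! h
  have hexp : ∀ m ∈ G.support, ∀ i, (m i : Ω) = 0 := by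
    intro m hm i
    by_cases hi : m i = 0
    · rw [hi, Nat.cast_zero]
    · have h1 := coeff_pderiv (i := i) G (m - Finsupp.single i 1)
      have h2 : m - Finsupp.single i 1 + Finsupp.single i 1 = m := by
        refine tsub_add_cancel_of_le ?_
        rw [Finsupp.single_le_iff]
        omega
      rw [h i, coeff_zero, h2] at h1
      have h3 := (mul_eq_zero.1 h1.symm).resolve_left (mem_support_iff.1 hm)
      have h4 : (m - Finsupp.single i 1 : σ →₀ ℕ) i + 1 = m i := by
        simpa using DFunLike.congr_fun h2 i
      rw [← h4]
      exact_mod_cast h3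
  obtain ⟨p, hp⟩ := ExpChar.exists Ω
  obtain _ | hprime := hp
  · apply hG.not_isUnit
    have hz : ∀ m ∈ G.support, m = 0 := fun m hm => by
      ext i
      exact_mod_cast hexp m hm i
    have : G = C (coeff 0 G) := by
      ext m
      rw [coeff_C]
      split_ifs with h0
      · rw [h0]
      · by_contra hm
        exact h0 (hz m (mem_support_iff.2 hm)).symm
    rw [this]
    refine IsUnit.map C (IsUnit.mk0 _ fun h0 => hG.ne_zero ?_)
    rw [this, h0, C_0]
  · have hF : Fact p.Prime := ⟨hprime⟩
    have hroot : ∀ m, ∃ c : Ω, c ^ p = coeff m G := fun m =>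
      IsAlgClosed.exists_pow_nat_eq _ hprime.pos
    choose r hr using hroot
    have hdiv : ∀ m ∈ G.support, ∃ m' : σ →₀ ℕ, p • m' = m := fun m hm => by
      refine ⟨m.mapRange (· / p) (by simp), ?_⟩
      ext i
      simpa using Nat.mul_div_cancel' ((CharP.cast_eq_zero_iff Ω p _).1 (hexp m hm i))
    choose! s hs using hdiv
    have key : G = (∑ m ∈ G.support, monomial (s m) (r m)) ^ p := by
      rw [sum_pow_char]
      conv_lhs => rw [G.as_sum]
      refine Finset.sum_congr rfl fun m hm => ?_
      rw [monomial_pow, hs m hm, hr]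
    rw [key] at hG
    exact not_irreducible_pow hprime.ne_one hG

/-- The derivation `∑ i, v i * ∂/∂Xᵢ`, the derivative in the direction `v`. -/
noncomputable def dirDeriv (v : Fin 3 → Ω) :
    Derivation Ω (MvPolynomial (Fin 3) Ω) (MvPolynomial (Fin 3) Ω) :=
  ∑ i, v i • pderiv i

theorem dirDeriv_apply (v : Fin 3 → Ω) (G : MvPolynomial (Fin 3) Ω) :
    dirDeriv v G = ∑ i, v i • pderiv i G := by
  simp [dirDeriv, Fin.sum_univ_three]

theorem dirDeriv_X (v : Fin 3 → Ω) (i : Fin 3) : dirDeriv v (X i) = C (v i) := by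
  rw [dirDeriv_apply, Finset.sum_eq_single i]
  · rw [pderiv_X_self, smul_eq_C_mul, mul_one]
  · intro j _ hj
    rw [pderiv_X_of_ne hj.symm, smul_zero]
  · simp

theorem dirDeriv_isHomogeneous (v : Fin 3 → Ω) {G : MvPolynomial (Fin 3) Ω} {d : ℕ}
    (hG : G.IsHomogeneous d) : (dirDeriv v G).IsHomogeneous (d - 1) := by
  rw [dirDeriv_apply]
  refine IsHomogeneous.sum _ _ _ fun i _ => ?_
  rw [smul_eq_C_mul]
  exact hG.pderiv.C_mul _

/-- For a general direction `v`, the derivative of a squarefree form in the direction `v` has no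
common factor with the form. The conditions `v 0 ≠ 0` and `eval v F ≠ 0` allow a linear change of
coordinates after which `F` is monic up to a constant, and the derivative is with respect to one of
the coordinates. -/
theorem exists_isRelPrime_dirDeriv [IsAlgClosed Ω] {F : MvPolynomial (Fin 3) Ω} {f : ℕ}
    (hF : F.IsHomogeneous f) (hsq : Squarefree F) :
    ∃ v : Fin 3 → Ω, v 0 ≠ 0 ∧ eval v F ≠ 0 ∧ IsRelPrime F (dirDeriv v F) := by
  classical
  have : Infinite Ω := IsAlgClosed.instInfinite
  have hF0 := hsq.ne_zero
  -- For each irreducible `G`, a nonzero linear condition on `v` that is implied by `D_v G = 0`.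
  have hlam : ∀ G : MvPolynomial (Fin 3) Ω, ∃ c : Fin 3 → Ω, Irreducible G →
      linForm c ≠ 0 ∧ ∀ v, dirDeriv v G = 0 → eval v (linForm c) = 0 := by
    intro G
    by_cases hG : Irreducible G
    · obtain ⟨i, hi⟩ := exists_pderiv_ne_zero hG
      obtain ⟨m, hm⟩ := ne_zero_iff.1 hi
      refine ⟨fun j => coeff m (pderiv j G), fun _ => ⟨fun h => hm ?_, fun v hv => ?_⟩⟩
      · simpa [eval_linForm, Pi.single_apply] using congrArg (eval (Pi.single i 1)) h
      · have := congrArg (coeff m) hv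
        rw [dirDeriv_apply, coeff_sum, coeff_zero] at this
        simpa [eval_linForm, mul_comm] using this
    · exact ⟨0, fun h => (hG h).elim⟩
  choose c hc using hlam
  let fac := (UniqueFactorizationMonoid.factors F)
  have hne : X 0 * F * (fac.map fun G => linForm (c G)).prod ≠ 0 := by
    refine mul_ne_zero (mul_ne_zero (X_ne_zero 0) hF0) (Multiset.prod_ne_zero fun h => ?_)
    obtain ⟨G, hG, h0⟩ := Multiset.mem_map.1 h
    exact (hc G (UniqueFactorizationMonoid.irreducible_of_factor G hG)).1 h0
  obtain ⟨v, hv⟩ := exists_eval_ne_zero hne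
  rw [map_mul, map_mul, eval_X] at hv
  have hv2 := right_ne_zero_of_mul hv
  refine ⟨v, left_ne_zero_of_mul (left_ne_zero_of_mul hv),
    right_ne_zero_of_mul (left_ne_zero_of_mul hv), ?_⟩
  refine (UniqueFactorizationMonoid.isRelPrime_iff_no_prime_factors hF0).2 fun d hdF hdD hd => ?_
  obtain ⟨G, hG, hass⟩ := UniqueFactorizationMonoid.exists_mem_factors_of_dvd hF0 hd.irreducible hdF
  have hirr := UniqueFactorizationMonoid.irreducible_of_factor G hG
  obtain ⟨Q, rfl⟩ := hass.symm.dvd.trans hdF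
  have hGp := UniqueFactorizationMonoid.irreducible_iff_prime.1 hirr
  have h1 : G ∣ dirDeriv v G * Q := by
    have h2 : G ∣ dirDeriv v (G * Q) := hass.symm.dvd.trans hdD
    rw [Derivation.leibniz, smul_eq_mul, smul_eq_mul] at h2
    rw [mul_comm]
    exact (dvd_add_right (dvd_mul_right G _)).1 h2
  rcases hGp.dvd_or_dvd h1 with h2 | h2
  · have hGhom := isHomogeneous_of_mul_left hF hF0
    have hdeg : G.totalDegree ≠ 0 := fun h0 => by
      rw [totalDegree_eq_zero_iff_eq_C.1 h0] at hirr
      refine hirr.not_isUnit (IsUnit.map C (IsUnit.mk0 _ fun h => hirr.ne_zero ?_))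
      rw [h, C_0]
    have h3 : dirDeriv v G = 0 := by
      by_contra h3
      obtain ⟨w, hw⟩ := h2
      have h4 := totalDegree_mul_of_isDomain (hirr.ne_zero) (right_ne_zero_of_mul (hw ▸ h3))
      rw [← hw, (dirDeriv_isHomogeneous v hGhom).totalDegree h3] at h4
      omega
    apply hv2
    rw [map_multiset_prod, Multiset.map_map]
    exact Multiset.prod_eq_zero (Multiset.mem_map.2 ⟨G, hG, (hc G hirr).2 v h3⟩)
  · exact hirr.not_isUnit (hsq G (mul_dvd_mul_left G h2))

end Derivative

/-! ### The derivative lies in the conductor: forms in three variables -/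

section Pencil
variable {Ω : Type*} [Field Ω]

/-- The homomorphism `Ω[X₀, X₁, X₂] → Ω[Y₀, Y₁][w]` given by a linear change of coordinates that
turns the derivative in the direction `v` into the derivative with respect to `w`. -/
noncomputable def pencilHom (v : Fin 3 → Ω) :
    MvPolynomial (Fin 3) Ω →ₐ[Ω] Polynomial (MvPolynomial (Fin 2) Ω) :=
  aeval ![Polynomial.C (C (v 0)) * Polynomial.X,
    Polynomial.C (X 0) + Polynomial.C (C (v 1)) * Polynomial.X,
    Polynomial.C (X 1) + Polynomial.C (C (v 2)) * Polynomial.X]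

theorem pencilHom_X (v : Fin 3 → Ω) (i : Fin 3) : pencilHom v (X i) =
    ![Polynomial.C (C (v 0)) * Polynomial.X,
    Polynomial.C (X 0) + Polynomial.C (C (v 1)) * Polynomial.X,
    Polynomial.C (X 1) + Polynomial.C (C (v 2)) * Polynomial.X] i := aeval_X _ _

theorem pencilHom_C (v : Fin 3 → Ω) (c : Ω) : pencilHom v (C c) = Polynomial.C (C c) := by
  rw [← algebraMap_eq, AlgHom.commutes]
  rfl

theorem pencilHom_bijective {v : Fin 3 → Ω} (hv : v 0 ≠ 0) : Function.Bijective (pencilHom v) := by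
  let ψ₀ : MvPolynomial (Fin 2) Ω →ₐ[Ω] MvPolynomial (Fin 3) Ω :=
    aeval ![X 1 - C (v 1 * (v 0)⁻¹) * X 0, X 2 - C (v 2 * (v 0)⁻¹) * X 0]
  let ψ : Polynomial (MvPolynomial (Fin 2) Ω) →+* MvPolynomial (Fin 3) Ω :=
    Polynomial.eval₂RingHom ψ₀.toRingHom (C (v 0)⁻¹ * X 0)
  have hC : ∀ c : Ω, ψ₀ (C c) = C c := fun c => by
    rw [← algebraMap_eq, AlgHom.commutes]
    rfl
  have hinv : (C (v 0)⁻¹ * C (v 0) : MvPolynomial (Fin 3) Ω) = 1 := by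
    rw [← C_mul, inv_mul_cancel₀ hv, C_1]
  have hinv' : (Polynomial.C (C (v 0)⁻¹) * Polynomial.C (C (v 0)) :
      Polynomial (MvPolynomial (Fin 2) Ω)) = 1 := by
    rw [← Polynomial.C_mul, ← C_mul, inv_mul_cancel₀ hv, C_1, Polynomial.C_1]
  have h1 : ψ.comp (pencilHom v : MvPolynomial (Fin 3) Ω →+* _) = RingHom.id _ := by
    refine MvPolynomial.ringHom_ext (fun c => ?_) fun i => ?_
    · simp [ψ, hC]
    · fin_cases i
      · simp only [RingHom.comp_apply, RingHom.coe_coe, pencilHom_X, Fin.zero_eta,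
          Matrix.cons_val_zero, ψ, Polynomial.coe_eval₂RingHom, Polynomial.eval₂_mul,
          Polynomial.eval₂_C, Polynomial.eval₂_X, AlgHom.toRingHom_eq_coe, hC, RingHom.id_apply]
        linear_combination X 0 * hinv
      · simp [pencilHom_X, ψ, ψ₀, mul_assoc]
      · simp [pencilHom_X, ψ, ψ₀, mul_assoc]
  have h2 : (pencilHom v : MvPolynomial (Fin 3) Ω →+* _).comp ψ = RingHom.id _ := by
    refine Polynomial.ringHom_ext' (MvPolynomial.ringHom_ext (fun c => ?_) fun i => ?_) ?_
    · simp [ψ, hC]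
    · fin_cases i
      · simp only [RingHom.comp_apply, RingHom.coe_coe, Fin.zero_eta, ψ,
          Polynomial.coe_eval₂RingHom, Polynomial.eval₂_C, AlgHom.toRingHom_eq_coe, ψ₀, aeval_X,
          Matrix.cons_val_zero, map_sub, map_mul, pencilHom_X, pencilHom_C, RingHom.id_apply,
          Matrix.cons_val_one]
        linear_combination (-Polynomial.C (C (v 1)) * Polynomial.X) * hinv'
      · simp only [RingHom.comp_apply, RingHom.coe_coe, Fin.mk_one, ψ,
          Polynomial.coe_eval₂RingHom, Polynomial.eval₂_C, AlgHom.toRingHom_eq_coe, ψ₀, aeval_X,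
          Matrix.cons_val_zero, map_sub, map_mul, pencilHom_X, pencilHom_C, RingHom.id_apply,
          Matrix.cons_val_one, Matrix.cons_val]
        linear_combination (-Polynomial.C (C (v 2)) * Polynomial.X) * hinv'
    · simp only [RingHom.comp_apply, RingHom.coe_coe, ψ, Polynomial.coe_eval₂RingHom,
        Polynomial.eval₂_X, map_mul, pencilHom_C, pencilHom_X, Matrix.cons_val_zero,
        RingHom.id_apply]
      linear_combination Polynomial.X * hinv'
  exact Function.bijective_iff_has_inverse.2
    ⟨ψ, fun x => RingHom.congr_fun h1 x, fun x => RingHom.congr_fun h2 x⟩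

theorem derivative_pencilHom (v : Fin 3 → Ω) (G : MvPolynomial (Fin 3) Ω) :
    Polynomial.derivative (pencilHom v G) = pencilHom v (dirDeriv v G) := by
  induction G using MvPolynomial.induction_on with
  | C a => rw [pencilHom_C, Polynomial.derivative_C, ← algebraMap_eq, Derivation.map_algebraMap,
      map_zero]
  | add p q hp hq => rw [map_add, Polynomial.derivative_add, hp, hq, map_add, map_add]
  | mul_X p i hp =>
    have hX : Polynomial.derivative (pencilHom v (X i)) = Polynomial.C (C (v i)) := by
      rw [pencilHom_X]
      fin_cases i <;> simp
    rw [map_mul, Polynomial.derivative_mul, hp, hX, Derivation.leibniz, dirDeriv_X, smul_eq_mul,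
      smul_eq_mul, map_add, map_mul, map_mul, pencilHom_C]
    ring

/-- The polynomial of a form of degree `d` has degree at most `d` in `w`, and the coefficient of
`w ^ d` is the value of the form at `v`. -/
theorem pencilHom_natDegree_le_and_coeff (v : Fin 3 → Ω) {G : MvPolynomial (Fin 3) Ω} {d : ℕ}
    (hG : G.IsHomogeneous d) :
    (pencilHom v G).natDegree ≤ d ∧ (pencilHom v G).coeff d = C (eval v G) := by
  have hX : ∀ i, (pencilHom v (X i)).natDegree ≤ 1 ∧
      (pencilHom v (X i)).coeff 1 = C (v i) := by
    intro i
    rw [pencilHom_X]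
    fin_cases i
    · exact ⟨by simp only [Fin.zero_eta, Matrix.cons_val_zero]; compute_degree, by simp⟩
    · exact ⟨by simp only [Fin.mk_one, Matrix.cons_val_one, Matrix.cons_val_zero]; compute_degree,
        by simp [Polynomial.coeff_C]⟩
    · exact ⟨by simp only [Fin.reduceFinMk, Matrix.cons_val]; compute_degree,
        by simp [Polynomial.coeff_C]⟩
  have hXpow : ∀ i n, (pencilHom v (X i) ^ n).natDegree ≤ n ∧
      (pencilHom v (X i) ^ n).coeff n = C (v i) ^ n := by
    intro i n
    refine ⟨by simpa using Polynomial.natDegree_pow_le_of_le n (hX i).1, ?_⟩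
    have := Polynomial.coeff_pow_of_natDegree_le (m := n) (hX i).1
    rwa [mul_one, (hX i).2] at this
  have hmon : ∀ m ∈ G.support,
      (pencilHom v (monomial m (coeff m G))).natDegree ≤ d ∧
      (pencilHom v (monomial m (coeff m G))).coeff d = C (eval v (monomial m (coeff m G))) := by
    intro m hm
    have hd : m 0 + m 1 + m 2 = d := by
      rw [← hG (mem_support_iff.1 hm), Pi.one_def, ← Finsupp.degree_eq_weight_one,
        Finsupp.degree_eq_sum, Fin.sum_univ_three]
    have h01 : (pencilHom v (X 0) ^ m 0 * pencilHom v (X 1) ^ m 1).natDegree ≤ m 0 + m 1 :=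
      Polynomial.natDegree_mul_le_of_le (hXpow 0 _).1 (hXpow 1 _).1
    have h : pencilHom v (monomial m (coeff m G)) = Polynomial.C (C (coeff m G)) *
        (pencilHom v (X 0) ^ m 0 * pencilHom v (X 1) ^ m 1 * pencilHom v (X 2) ^ m 2) := by
      rw [monomial_eq, map_mul, pencilHom_C, Finsupp.prod_fintype _ _ (by simp),
        Fin.prod_univ_three]
      simp only [map_mul, map_pow]
    rw [h]
    refine ⟨(Polynomial.natDegree_C_mul_le _ _).trans (hd ▸
      Polynomial.natDegree_mul_le_of_le h01 (hXpow 2 _).1), ?_⟩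
    rw [Polynomial.coeff_C_mul, ← hd,
      Polynomial.coeff_mul_add_eq_of_natDegree_le h01 (hXpow 2 _).1,
      Polynomial.coeff_mul_add_eq_of_natDegree_le (hXpow 0 _).1 (hXpow 1 _).1, (hXpow 0 _).2,
      (hXpow 1 _).2, (hXpow 2 _).2, eval_monomial, Finsupp.prod_fintype _ _ (by simp),
      Fin.prod_univ_three]
    simp only [map_mul, map_pow]
  rw [G.as_sum, map_sum, Polynomial.finsetSum_coeff, map_sum, map_sum]
  exact ⟨Polynomial.natDegree_sum_le_of_forall_le _ _ fun m hm => (hmon m hm).1,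
    Finset.sum_congr rfl fun m hm => (hmon m hm).2⟩

theorem isRelPrime_map_of_bijective {A B : Type*} [CommRing A] [CommRing B] {φ : A →+* B}
    (hφ : Function.Bijective φ) {a b : A} (h : IsRelPrime a b) : IsRelPrime (φ a) (φ b) := by
  let e := RingEquiv.ofBijective φ hφ
  intro d hd hd'
  have h1 : ∀ c : A, d ∣ φ c → e.symm d ∣ c := fun c hc => by
    rw [show c = e.symm (φ c) from (e.symm_apply_apply c).symm]
    exact map_dvd e.symm hc
  have := (h (h1 a hd) (h1 b hd')).map e
  rwa [e.apply_symm_apply] at this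

/-- The derivative of a form lies in the conductor, for a form `F` that is monic in the direction
`v` and has no common factor with its derivative in this direction. -/
theorem exists_dvd_dirDeriv_mul_sub {v : Fin 3 → Ω} (hv : v 0 ≠ 0)
    {F M N T : MvPolynomial (Fin 3) Ω} {f : ℕ} (hF : F.IsHomogeneous f) (hvF : eval v F = 1)
    (hsep : IsRelPrime F (dirDeriv v F)) (hM : IsRelPrime F M) (hT : IsRelPrime F T) (n : ℕ)
    (A : ℕ → MvPolynomial (Fin 3) Ω)
    (hA : A n ≠ 0) (hp : F ∣ T * ∑ i ∈ Finset.range (n + 1), A i * N ^ i * M ^ (n - i)) :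
    ∃ Q, F ∣ dirDeriv v F * (A n * N) - M * Q := by
  have hbij := pencilHom_bijective hv
  let φ : MvPolynomial (Fin 3) Ω →+* Polynomial (MvPolynomial (Fin 2) Ω) := pencilHom v
  obtain ⟨hdeg, hcoeff⟩ := pencilHom_natDegree_le_and_coeff v hF
  rw [hvF, C_1] at hcoeff
  have hmonic : (φ F).Monic := Polynomial.monic_of_natDegree_le_of_coeff_eq_one f hdeg hcoeff
  let p : Polynomial (Polynomial (MvPolynomial (Fin 2) Ω)) :=
    ∑ i ∈ Finset.range (n + 1), Polynomial.monomial i (φ (A i))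
  have hpc : ∀ i ≤ n, p.coeff i = φ (A i) := by
    intro i hi
    simp only [p, Polynomial.finsetSum_coeff, Polynomial.coeff_monomial, Finset.sum_ite_eq',
      Finset.mem_range]
    rw [if_pos (by omega)]
  have hAn : φ (A n) ≠ 0 := fun h => hA (hbij.1 (by rw [map_zero]; exact h))
  have hpd : p.natDegree = n := by
    apply le_antisymm
    · refine Polynomial.natDegree_sum_le_of_forall_le _ _ fun i hi => ?_
      have := Finset.mem_range.1 hi
      exact (Polynomial.natDegree_monomial_le _).trans (by omega)
    · exact Polynomial.le_natDegree_of_ne_zero (by rwa [hpc n le_rfl])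
  have hlc : p.leadingCoeff = φ (A n) := by
    rw [Polynomial.leadingCoeff, hpd, hpc n le_rfl]
  obtain ⟨Q', hQ'⟩ := exists_dvd_derivative_mul_sub (f := φ F) (M := φ M) (N := φ N) (T := φ T)
    (FractionRing (MvPolynomial (Fin 2) Ω))
    (AlgebraicClosure (FractionRing (MvPolynomial (Fin 2) Ω))) hmonic
    (by
      change IsRelPrime _ (Polynomial.derivative (pencilHom v F))
      rw [derivative_pencilHom]
      exact isRelPrime_map_of_bijective (φ := φ) hbij hsep)
    (isRelPrime_map_of_bijective hbij hM) (isRelPrime_map_of_bijective hbij hT) p (by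
      have h1 := map_dvd φ hp
      rw [map_mul, map_sum] at h1
      rw [hpd]
      convert! h1 using 2
      refine Finset.sum_congr rfl fun i hi => ?_
      have := Finset.mem_range.1 hi
      rw [hpc i (by omega), map_mul, map_mul, map_pow, map_pow])
  obtain ⟨Q, rfl⟩ := hbij.2 Q'
  refine ⟨Q, ?_⟩
  obtain ⟨Y, hY⟩ := hQ'
  obtain ⟨Y, rfl⟩ := hbij.2 Y
  refine ⟨Y, hbij.1 ?_⟩
  rw [hlc] at hY
  change Polynomial.derivative (pencilHom v F) * _ - _ = _ at hY
  rw [derivative_pencilHom] at hY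
  simp only [map_sub, map_mul]
  exact hY

/-- A form is the product of a form whose prime factors all vanish at the point `x` and of a form
that does not vanish at `x`; the former may be normalized by its value at a further point `v`. -/
theorem exists_mul_eq_of_eval_ne_zero {F : MvPolynomial (Fin 3) Ω} (x : Fin 3 → Ω)
    {v : Fin 3 → Ω} (hv : eval v F ≠ 0) :
    ∃ F₁ F₂ : MvPolynomial (Fin 3) Ω, F = F₁ * F₂ ∧ eval x F₂ ≠ 0 ∧ eval v F₁ = 1 ∧
      ∀ p, Prime p → p ∣ F₁ → eval x p = 0 := by
  have key : ∀ F : MvPolynomial (Fin 3) Ω, F ≠ 0 →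
      ∃ F₁ F₂ : MvPolynomial (Fin 3) Ω, F = F₁ * F₂ ∧ eval x F₂ ≠ 0 ∧
        ∀ p, Prime p → p ∣ F₁ → eval x p = 0 := by
    intro F
    induction F using UniqueFactorizationMonoid.induction_on_prime with
    | h₁ => exact fun h => (h rfl).elim
    | h₂ u hu =>
      exact fun _ => ⟨1, u, (one_mul u).symm, (hu.map (eval x)).ne_zero,
        fun p hp h => (hp.not_isUnit (isUnit_of_dvd_one h)).elim⟩
    | h₃ a p ha hp ih =>
      intro _
      obtain ⟨F₁, F₂, rfl, h2, h3⟩ := ih ha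
      by_cases h : eval x p = 0
      · refine ⟨p * F₁, F₂, (mul_assoc _ _ _).symm, h2, fun q hq hqd => ?_⟩
        rcases hq.dvd_or_dvd hqd with h4 | h4
        · obtain ⟨w, rfl⟩ := (hq.associated_of_dvd hp h4).symm.dvd
          rw [map_mul, h, zero_mul]
        · exact h3 q hq h4
      · exact ⟨F₁, p * F₂, by ring, by rw [map_mul]; exact mul_ne_zero h h2, h3⟩
  obtain ⟨F₁, F₂, rfl, h2, h3⟩ := key F (fun h => hv (by rw [h, map_zero]))
  rw [map_mul] at hv
  have hv1 := left_ne_zero_of_mul hv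
  refine ⟨C (eval v F₁)⁻¹ * F₁, C (eval v F₁) * F₂, ?_, ?_, ?_, fun p hp hpd => ?_⟩
  · have : (C (eval v F₁)⁻¹ * C (eval v F₁) : MvPolynomial (Fin 3) Ω) = 1 := by
      rw [← C_mul, inv_mul_cancel₀ hv1, C_1]
    linear_combination (-F₁ * F₂) * this
  · rw [map_mul, eval_C]
    exact mul_ne_zero hv1 h2
  · rw [map_mul, eval_C, inv_mul_cancel₀ hv1]
  · refine h3 p hp ((hp.dvd_or_dvd hpd).resolve_left fun h => hp.not_isUnit ?_)
    exact isUnit_of_dvd_unit h (IsUnit.map C (IsUnit.mk0 _ (inv_ne_zero hv1)))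

/-- A local version of the fact that the derivative of the form `F` in a direction `v` with
`F(v) ≠ 0` lies in the conductor: only the factors of `F` vanishing at the point `x` matter. -/
theorem exists_local_dirDeriv_mul_sub {v : Fin 3 → Ω} (hv : v 0 ≠ 0)
    {F M N T : MvPolynomial (Fin 3) Ω} {f : ℕ} (hF : F.IsHomogeneous f) (hvF : eval v F ≠ 0)
    (hsep : IsRelPrime F (dirDeriv v F)) (x : Fin 3 → Ω)
    (hM : ∀ p, Prime p → eval x p = 0 → p ∣ F → ¬ p ∣ M) (hT : eval x T ≠ 0) (n : ℕ)
    (A : ℕ → MvPolynomial (Fin 3) Ω) {a : ℕ} (hA : (A n).IsHomogeneous a) (hAx : eval x (A n) ≠ 0)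
    (hp : F ∣ T * ∑ i ∈ Finset.range (n + 1), A i * N ^ i * M ^ (n - i)) :
    ∃ (e : ℕ) (E Q : MvPolynomial (Fin 3) Ω), E.IsHomogeneous e ∧ eval x E ≠ 0 ∧
      F ∣ dirDeriv v F * (E * N) - M * Q := by
  obtain ⟨F₁, F₂, rfl, hF2, hF1, hprime⟩ := exists_mul_eq_of_eval_ne_zero x hvF
  have hF0 : F₁ * F₂ ≠ 0 := fun h => hvF (by rw [h, map_zero])
  have hF10 : F₁ ≠ 0 := left_ne_zero_of_mul hF0
  have hD : dirDeriv v (F₁ * F₂) = F₁ * dirDeriv v F₂ + F₂ * dirDeriv v F₁ := by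
    rw [Derivation.leibniz, smul_eq_mul, smul_eq_mul]
  have hrel : ∀ {G : MvPolynomial (Fin 3) Ω}, (∀ p, Prime p → p ∣ F₁ → ¬ p ∣ G) →
      IsRelPrime F₁ G := fun h =>
    (UniqueFactorizationMonoid.isRelPrime_iff_no_prime_factors hF10).2
      fun d h1 h2 hd => h d hd h1 h2
  obtain ⟨Q, Y, hY⟩ := exists_dvd_dirDeriv_mul_sub hv (isHomogeneous_of_mul_left hF hF0) hF1
    (hrel fun p hp h1 h2 => hp.not_isUnit (hsep (h1.mul_right _) (by
      rw [hD]
      exact dvd_add (h1.mul_right _) (h2.mul_left _))))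
    (hrel fun p hp h1 => hM p hp (hprime p hp h1) (h1.mul_right _))
    (hrel (G := T) fun p hpp h1 h2 => hT (by
      obtain ⟨w, rfl⟩ := h2
      rw [map_mul, hprime p hpp h1, zero_mul]))
    n A (fun h => hAx (by rw [h, map_zero])) ((dvd_mul_right _ _).trans hp)
  -- Multiplying by `F₂` makes the term with the derivative of `F₂` a multiple of `F₁ * F₂`.
  refine ⟨_, F₂ * A n, F₂ * F₂ * Q, (isHomogeneous_of_mul_right hF hF0).mul hA,
    by rw [map_mul]; exact mul_ne_zero hF2 hAx, F₂ * Y + dirDeriv v F₂ * (A n * N), ?_⟩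
  rw [hD]
  linear_combination F₂ * F₂ * hY

end Pencil

/-! ### Germs of functions on a plane curve -/

section LocalRing
variable {Ω : Type*} [Field Ω] {P : ℙ Ω (Fin 3 → Ω)}

local notation "ι" => algebraMap (MvPolynomial (Fin 3) Ω) (FractionRing (MvPolynomial (Fin 3) Ω))

theorem algebraMap_fractionRing_injective : Function.Injective ι :=
  IsFractionRing.injective _ _

theorem algebraMap_ne_zero_of_eval {D : MvPolynomial (Fin 3) Ω} {x : Fin 3 → Ω}
    (h : eval x D ≠ 0) : ι D ≠ 0 := fun h0 => h (by
  rw [algebraMap_fractionRing_injective (h0.trans (map_zero _).symm), map_zero])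

/-- The germ at `P` of the function `N / D`. -/
noncomputable def germ {N D : MvPolynomial (Fin 3) Ω} {d : ℕ} (hN : N.IsHomogeneous d)
    (hD : D.IsHomogeneous d) (hP : eval P.rep D ≠ 0) : planeLocalRing P :=
  ⟨ι N / ι D, d, N, D, hN, hD, hP, rfl⟩

theorem coe_germ {N D : MvPolynomial (Fin 3) Ω} {d : ℕ} (hN : N.IsHomogeneous d)
    (hD : D.IsHomogeneous d) (hP : eval P.rep D ≠ 0) :
    (germ hN hD hP : FractionRing (MvPolynomial (Fin 3) Ω)) = ι N / ι D := rfl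

/-- Finitely many elements of the local ring have a common denominator, of any degree that is
large enough. -/
theorem exists_common_denominator (s : Finset (planeLocalRing P)) (d₀ : ℕ) :
    ∃ d ≥ d₀, ∃ D : MvPolynomial (Fin 3) Ω, D.IsHomogeneous d ∧ eval P.rep D ≠ 0 ∧
      ∃ num : planeLocalRing P → MvPolynomial (Fin 3) Ω, ∀ r ∈ s, (num r).IsHomogeneous d ∧
        (r : FractionRing (MvPolynomial (Fin 3) Ω)) = ι (num r) / ι D := by
  classical
  suffices h : ∃ d ≥ d₀, ∃ D : MvPolynomial (Fin 3) Ω, D.IsHomogeneous d ∧ eval P.rep D ≠ 0 ∧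
      ∀ r ∈ s, ∃ N : MvPolynomial (Fin 3) Ω, N.IsHomogeneous d ∧
        (r : FractionRing (MvPolynomial (Fin 3) Ω)) = ι N / ι D by
    obtain ⟨d, hd, D, hD, hP, hs⟩ := h
    choose! num hnum using hs
    exact ⟨d, hd, D, hD, hP, num, hnum⟩
  induction s using Finset.induction_on with
  | empty =>
    obtain ⟨c, hc⟩ := exists_linForm_ne_zero P.rep_nonzero
    exact ⟨d₀, le_rfl, linForm c ^ d₀, by simpa using (linForm_isHomogeneous c).pow d₀,
      by rw [map_pow]; exact pow_ne_zero _ hc, by simp⟩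
  | insert r s _ ih =>
    obtain ⟨d, hd, D, hD, hP, hs⟩ := ih
    obtain ⟨e, N, E, hN, hE, hPE, hr⟩ := r.2
    have hD0 := algebraMap_ne_zero_of_eval hP
    have hE0 := algebraMap_ne_zero_of_eval hPE
    refine ⟨d + e, by omega, D * E, hD.mul hE, by rw [map_mul]; exact mul_ne_zero hP hPE, ?_⟩
    intro r' hr'
    rcases Finset.mem_insert.1 hr' with rfl | h
    · refine ⟨D * N, hD.mul hN, ?_⟩
      rw [hr, map_mul, map_mul]
      field_simp
    · obtain ⟨N', hN', h'⟩ := hs r' h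
      refine ⟨N' * E, hN'.mul hE, ?_⟩
      rw [h', map_mul, map_mul]
      field_simp

theorem mem_curveIdeal_iff {F : MvPolynomial (Fin 3) Ω} {z : planeLocalRing P} :
    z ∈ curveIdeal F P ↔ ∃ (d : ℕ) (G D : MvPolynomial (Fin 3) Ω),
      (F * G).IsHomogeneous d ∧ D.IsHomogeneous d ∧ eval P.rep D ≠ 0 ∧
        (z : FractionRing (MvPolynomial (Fin 3) Ω)) = ι (F * G) / ι D := by
  refine ⟨fun h => ?_, fun h => Ideal.subset_span h⟩
  induction h using Submodule.span_induction with
  | mem z h => exact h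
  | zero =>
    exact ⟨0, 0, 1, by rw [mul_zero]; exact isHomogeneous_zero _ _ _, isHomogeneous_one _ _,
      by simp, by simp⟩
  | add z w _ _ hz hw =>
    obtain ⟨d, G, D, hG, hD, hP, hz⟩ := hz
    obtain ⟨e, G', D', hG', hD', hP', hw⟩ := hw
    have hD0 := algebraMap_ne_zero_of_eval hP
    have hD0' := algebraMap_ne_zero_of_eval hP'
    have heq : F * (G * D' + D * G') = F * G * D' + D * (F * G') := by ring
    refine ⟨d + e, G * D' + D * G', D * D', ?_, hD.mul hD',
      by rw [map_mul]; exact mul_ne_zero hP hP', ?_⟩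
    · rw [heq]
      exact (hG.mul hD').add (hD.mul hG')
    · rw [Subalgebra.coe_add, hz, hw, heq, div_add_div _ _ hD0 hD0']
      simp only [map_add, map_mul]
  | smul a z _ hz =>
    obtain ⟨d, G, D, hG, hD, hP, hz⟩ := hz
    obtain ⟨e, N, E, hN, hE, hPE, ha⟩ := a.2
    have heq : F * (N * G) = N * (F * G) := by ring
    refine ⟨e + d, N * G, E * D, ?_, hE.mul hD, by rw [map_mul]; exact mul_ne_zero hPE hP, ?_⟩
    · rw [heq]
      exact hN.mul hG
    · rw [smul_eq_mul, Subalgebra.coe_mul, hz, ha, heq, div_mul_div_comm]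
      simp only [map_mul]

theorem mem_curveIdeal_of_dvd {F N D : MvPolynomial (Fin 3) Ω} {d : ℕ} (hN : N.IsHomogeneous d)
    (hD : D.IsHomogeneous d) (hP : eval P.rep D ≠ 0) {z : planeLocalRing P}
    (hz : (z : FractionRing (MvPolynomial (Fin 3) Ω)) = ι N / ι D) (h : F ∣ N) :
    z ∈ curveIdeal F P := by
  obtain ⟨G, rfl⟩ := h
  exact mem_curveIdeal_iff.2 ⟨d, G, D, hN, hD, hP, hz⟩

theorem exists_dvd_of_mem_curveIdeal {F N D : MvPolynomial (Fin 3) Ω} (hP : eval P.rep D ≠ 0)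
    {z : planeLocalRing P} (hz : (z : FractionRing (MvPolynomial (Fin 3) Ω)) = ι N / ι D)
    (h : z ∈ curveIdeal F P) :
    ∃ (e : ℕ) (T : MvPolynomial (Fin 3) Ω), T.IsHomogeneous e ∧ eval P.rep T ≠ 0 ∧
      F ∣ T * N := by
  obtain ⟨e, G, T, -, hT, hPT, h⟩ := mem_curveIdeal_iff.1 h
  refine ⟨e, T, hT, hPT, G * D, algebraMap_fractionRing_injective ?_⟩
  rw [hz, div_eq_div_iff (algebraMap_ne_zero_of_eval hP) (algebraMap_ne_zero_of_eval hPT)] at h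
  rw [← map_mul, ← map_mul] at h
  rw [mul_comm T, h]
  ring_nf

/-- The numerator of a germ that is a nonzerodivisor on the curve is not divisible by any prime
factor of the equation of the curve that vanishes at `P`. -/
theorem not_dvd_of_nonzerodivisor {F M D : MvPolynomial (Fin 3) Ω} {f d : ℕ}
    (hF : F.IsHomogeneous f) (hF0 : F ≠ 0) (hM : M.IsHomogeneous d) (hD : D.IsHomogeneous d)
    (hP : eval P.rep D ≠ 0) {q : planeLocalRing P}
    (hq : (q : FractionRing (MvPolynomial (Fin 3) Ω)) = ι M / ι D)
    (hqz : ∀ r, q * r ∈ curveIdeal F P → r ∈ curveIdeal F P)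
    {p : MvPolynomial (Fin 3) Ω} (hpP : eval P.rep p = 0) (hpF : p ∣ F) : ¬ p ∣ M := by
  rintro ⟨M', rfl⟩
  obtain ⟨F', rfl⟩ := hpF
  have hF' := isHomogeneous_of_mul_right hF hF0
  obtain ⟨c, hc⟩ := exists_linForm_ne_zero P.rep_nonzero
  have hl : (linForm c ^ F'.totalDegree).IsHomogeneous F'.totalDegree := by
    simpa using (linForm_isHomogeneous c).pow F'.totalDegree
  have hlP : eval P.rep (linForm c ^ F'.totalDegree) ≠ 0 := by
    rw [map_pow]
    exact pow_ne_zero _ hc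
  have h2 : germ hF' hl hlP ∈ curveIdeal (p * F') P := by
    refine hqz _ (mem_curveIdeal_of_dvd (N := p * M' * F') (hM.mul hF') (hD.mul hl)
      (by rw [map_mul]; exact mul_ne_zero hP hlP) ?_ ⟨M', by ring⟩)
    rw [Subalgebra.coe_mul, hq, coe_germ, div_mul_div_comm, ← map_mul, ← map_mul]
  obtain ⟨e, T, -, hT, G, hG⟩ := exists_dvd_of_mem_curveIdeal hlP (coe_germ hF' hl hlP) h2
  refine hT ?_
  have h3 : T = p * G := mul_right_cancel₀ (right_ne_zero_of_mul hF0) (by rw [hG]; ring)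
  rw [h3, map_mul, hpP, zero_mul]

/-- The germ at `P` of the derivative of `F` in the direction `v`, divided by a power of a linear
form `c` that does not vanish at `P`. -/
noncomputable def dirDerivGerm {F : MvPolynomial (Fin 3) Ω} {f : ℕ} (hF : F.IsHomogeneous f)
    (v : Fin 3 → Ω) {c : Fin 3 → Ω} (hc : eval P.rep (linForm c) ≠ 0) : planeLocalRing P :=
  germ (dirDeriv_isHomogeneous v hF)
    (by simpa using (linForm_isHomogeneous c).pow (f - 1) :
      (linForm c ^ (f - 1)).IsHomogeneous (f - 1))
    (by rw [map_pow]; exact pow_ne_zero _ hc)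

/-- The derivative of `F` in a general direction multiplies the normalization of the local ring of
the curve into the local ring: here `p / q` is a fraction that is integral over the local ring,
the equation of integral dependence being given with its denominators cleared. -/
theorem exists_dirDerivGerm_mul_sub_mem {F : MvPolynomial (Fin 3) Ω} {f : ℕ}
    (hF : F.IsHomogeneous f) {v : Fin 3 → Ω} (hv : v 0 ≠ 0) (hvF : eval v F ≠ 0)
    (hsep : IsRelPrime F (dirDeriv v F)) {c : Fin 3 → Ω} (hc : eval P.rep (linForm c) ≠ 0)
    {p q : planeLocalRing P} (hq : ∀ r, q * r ∈ curveIdeal F P → r ∈ curveIdeal F P) {n : ℕ}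
    {a : ℕ → planeLocalRing P} (ha : a n = 1)
    (hmem : ∑ i ∈ Finset.range (n + 1), a i * p ^ i * q ^ (n - i) ∈ curveIdeal F P) :
    ∃ o : planeLocalRing P, dirDerivGerm hF v hc * p - o * q ∈ curveIdeal F P := by
  classical
  have hF0 : F ≠ 0 := fun h => hvF (by rw [h, map_zero])
  obtain ⟨d, hd, D, hD, hDP, num, hnum⟩ := exists_common_denominator
    (insert p (insert q ((Finset.range (n + 1)).image a))) 1
  have hD0 := algebraMap_ne_zero_of_eval hDP
  obtain ⟨hN, hpN⟩ := hnum p (by simp)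
  obtain ⟨hM, hqM⟩ := hnum q (by simp)
  have hA : ∀ i ∈ Finset.range (n + 1), (num (a i)).IsHomogeneous d ∧
      (a i : FractionRing (MvPolynomial (Fin 3) Ω)) = ι (num (a i)) / ι D := fun i hi =>
    hnum (a i) (Finset.mem_insert_of_mem (Finset.mem_insert_of_mem (Finset.mem_image_of_mem a hi)))
  obtain ⟨hAn, hAn'⟩ := hA n (by simp)
  have hAD : num (a n) = D := by
    rw [ha] at hAn' ⊢
    rw [Subalgebra.coe_one, eq_div_iff hD0, one_mul] at hAn'
    exact (algebraMap_fractionRing_injective hAn').symm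
  obtain ⟨e, T, -, hT, hdvd⟩ := exists_dvd_of_mem_curveIdeal (F := F)
    (N := ∑ i ∈ Finset.range (n + 1), num (a i) * num p ^ i * num q ^ (n - i)) (D := D ^ (n + 1))
    (by rw [map_pow]; exact pow_ne_zero _ hDP) (by
      rw [AddSubmonoidClass.coe_finsetSum, map_sum, Finset.sum_div]
      refine Finset.sum_congr rfl fun i hi => ?_
      rw [Subalgebra.coe_mul, Subalgebra.coe_mul, Subalgebra.coe_pow, Subalgebra.coe_pow,
        (hA i hi).2, hpN, hqM]
      obtain ⟨j, hj⟩ := Nat.exists_eq_add_of_le (show i ≤ n by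
        have := Finset.mem_range.1 hi
        omega)
      rw [hj, Nat.add_sub_cancel_left, map_mul, map_mul, map_pow, map_pow, map_pow, div_pow,
        div_pow, pow_succ, pow_add]
      field_simp) hmem
  obtain ⟨e', E, Q, hE, hEP, Y, hY⟩ := exists_local_dirDeriv_mul_sub hv (M := num q) (N := num p)
    (T := T) hF hvF hsep P.rep
    (fun w _ hwP hwF => not_dvd_of_nonzerodivisor hF hF0 hM hD hDP hqM hq hwP hwF)
    hT n (fun i => num (a i)) hAn (by rw [hAD]; exact hDP) hdvd
  -- The homogeneous part of the relevant degree of the relation found.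
  have hL : (dirDeriv v F * (E * num p)).IsHomogeneous (f - 1 + (e' + d)) :=
    (dirDeriv_isHomogeneous v hF).mul (hE.mul hN)
  set Q₀ := homogeneousComponent (f - 1 + e') Q
  have hQ₀ : Q₀.IsHomogeneous (f - 1 + e') := homogeneousComponent_isHomogeneous _ _
  have hdvd0 : F ∣ dirDeriv v F * (E * num p) - num q * Q₀ := by
    refine ⟨homogeneousComponent (f - 1 + (e' + d) - f) Y, ?_⟩
    rw [← homogeneousComponent_mul_of_isHomogeneous hF,
      ← homogeneousComponent_mul_of_isHomogeneous hM,
      show f + (f - 1 + (e' + d) - f) = f - 1 + (e' + d) by omega,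
      show d + (f - 1 + e') = f - 1 + (e' + d) by ring, ← hY, map_sub,
      homogeneousComponent_of_isHomogeneous hL]
  have hlc : (linForm c ^ (f - 1)).IsHomogeneous (f - 1) := by
    simpa using (linForm_isHomogeneous c).pow (f - 1)
  have hlP : eval P.rep (linForm c ^ (f - 1)) ≠ 0 := by
    rw [map_pow]
    exact pow_ne_zero _ hc
  have hlE : eval P.rep (linForm c ^ (f - 1) * E) ≠ 0 := by
    rw [map_mul]
    exact mul_ne_zero hlP hEP
  have hl0 := algebraMap_ne_zero_of_eval hlP
  have hE0 := algebraMap_ne_zero_of_eval hEP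
  refine ⟨germ hQ₀ (hlc.mul hE) hlE, mem_curveIdeal_of_dvd
    (N := dirDeriv v F * (E * num p) - num q * Q₀) (D := linForm c ^ (f - 1) * (E * D))
    (d := f - 1 + (e' + d)) (hL.sub ?_) (hlc.mul (hE.mul hD)) ?_ ?_ hdvd0⟩
  · rw [show f - 1 + (e' + d) = d + (f - 1 + e') by ring]
    exact hM.mul hQ₀
  · rw [map_mul, map_mul]
    exact mul_ne_zero hlP (mul_ne_zero hEP hDP)
  · rw [Subalgebra.coe_sub, Subalgebra.coe_mul, Subalgebra.coe_mul, dirDerivGerm, coe_germ,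
      coe_germ, hpN, hqM]
    simp only [map_mul, map_sub]
    field_simp

/-! ### The delta invariants of a plane curve -/

/-- An ideal of the local ring of the plane has finite codimension if it contains the germs of the
forms of large degree in the ideal of two forms `A`, `B` without common factor: a family of germs
with common denominator is dependent as soon as its numerators are dependent modulo `(A, B)`. -/
theorem finite_quotient_of_isRelPrime {A B : MvPolynomial (Fin 3) Ω} {a b : ℕ}
    (hA : A.IsHomogeneous a) (hB : B.IsHomogeneous b) (hA0 : A ≠ 0) (hB0 : B ≠ 0)
    (hAB : IsRelPrime A B) (J : Ideal (planeLocalRing P))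
    (hJ : ∀ d ≥ a + b, ∀ (N D : MvPolynomial (Fin 3) Ω) (hN : N.IsHomogeneous d)
      (hD : D.IsHomogeneous d) (hP : eval P.rep D ≠ 0), N ∈ Ideal.span {A, B} →
      germ hN hD hP ∈ J) :
    Module.Finite Ω (planeLocalRing P ⧸ J) := by
  classical
  refine finite_of_forall_card_le (a * b) fun s hs => ?_
  choose r hr using fun x : planeLocalRing P ⧸ J => Ideal.Quotient.mk_surjective x
  obtain ⟨d, hd, D, hD, hP, num, hnum⟩ := exists_common_denominator (s.image r) (a + b)
  have hs' : ∀ x : s, (num (r x)).IsHomogeneous d ∧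
      (r x : FractionRing (MvPolynomial (Fin 3) Ω)) = ι (num (r x)) / ι D := fun x =>
    hnum _ (Finset.mem_image_of_mem r x.2)
  let g : s → formsMod (Ideal.span {A, B}) d := fun x => ⟨_, mk_mem_formsMod _ (hs' x).1⟩
  have hli : LinearIndependent Ω g := by
    rw [Fintype.linearIndependent_iff]
    intro u hu
    refine hs u ?_
    have h1 : ∑ x, u x • num (r x) ∈ Ideal.span {A, B} := by
      rw [← Ideal.Quotient.eq_zero_iff_mem, ← Ideal.Quotient.mkₐ_eq_mk Ω, map_sum]
      have hu' := congrArg Subtype.val hu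
      rw [AddSubmonoidClass.coe_finsetSum] at hu'
      exact (Finset.sum_congr rfl fun x _ => map_smul _ _ _).trans hu'
    have h2 : (∑ x, u x • num (r x)).IsHomogeneous d :=
      IsHomogeneous.sum _ _ _ fun x _ => by
        rw [smul_eq_C_mul]
        exact (hs' x).1.C_mul _
    have h3 := hJ d hd _ D h2 hD hP h1
    have h4 : germ h2 hD hP = ∑ x, u x • r x := by
      apply Subtype.ext
      rw [coe_germ, AddSubmonoidClass.coe_finsetSum, map_sum, Finset.sum_div]
      refine Finset.sum_congr rfl fun x _ => ?_
      rw [Subalgebra.coe_smul, (hs' x).2, smul_eq_C_mul, map_mul, mul_div_assoc, Algebra.smul_def,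
        IsScalarTower.algebraMap_apply Ω (MvPolynomial (Fin 3) Ω), MvPolynomial.algebraMap_eq]
    rw [h4, ← Ideal.Quotient.eq_zero_iff_mem, ← Ideal.Quotient.mkₐ_eq_mk Ω, map_sum] at h3
    rw [← h3]
    refine Finset.sum_congr rfl fun x _ => ?_
    rw [map_smul, Ideal.Quotient.mkₐ_eq_mk, hr]
  have h5 := hli.fintype_card_le_finrank
  obtain ⟨m, rfl⟩ := Nat.exists_eq_add_of_le hd
  rwa [finrank_formsMod hA hB hA0 hB0 hAB, Fintype.card_coe] at h5

/-- A fraction lies in the ideal of the curve if its numerator is divisible by the equation of the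
curve, up to a factor that does not vanish at `P`. -/
theorem mem_curveIdeal_of_dvd_mul {F N D T : MvPolynomial (Fin 3) Ω} {d e : ℕ}
    (hN : N.IsHomogeneous d) (hD : D.IsHomogeneous d) (hP : eval P.rep D ≠ 0)
    (hT : T.IsHomogeneous e) (hTP : eval P.rep T ≠ 0) {z : planeLocalRing P}
    (hz : (z : FractionRing (MvPolynomial (Fin 3) Ω)) = ι N / ι D) (h : F ∣ T * N) :
    z ∈ curveIdeal F P := by
  refine mem_curveIdeal_of_dvd (hT.mul hN) (hT.mul hD)
    (by rw [map_mul]; exact mul_ne_zero hTP hP) ?_ h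
  rw [hz, map_mul, map_mul, mul_div_mul_left _ _ (algebraMap_ne_zero_of_eval hTP)]

section GeneralDirection
variable {F : MvPolynomial (Fin 3) Ω} {f : ℕ} (hF : F.IsHomogeneous f) {v c : Fin 3 → Ω}
  (hc : eval P.rep (linForm c) ≠ 0)

/-- The derivative in a general direction is a nonzerodivisor on the curve. -/
theorem mem_curveIdeal_of_dirDerivGerm_mul_mem (hsep : IsRelPrime F (dirDeriv v F))
    (r : planeLocalRing P) (h : dirDerivGerm hF v hc * r ∈ curveIdeal F P) :
    r ∈ curveIdeal F P := by
  obtain ⟨d, N, D, hN, hD, hP, hr⟩ := r.2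
  obtain ⟨e, T, hT, hTP, hdvd⟩ := exists_dvd_of_mem_curveIdeal (N := dirDeriv v F * N)
    (D := linForm c ^ (f - 1) * D)
    (by rw [map_mul, map_pow]; exact mul_ne_zero (pow_ne_zero _ hc) hP)
    (by
      rw [Subalgebra.coe_mul, dirDerivGerm, coe_germ, hr, div_mul_div_comm, ← map_mul,
        ← map_mul]) h
  refine mem_curveIdeal_of_dvd_mul hN hD hP hT hTP hr ?_
  rw [mul_left_comm] at hdvd
  exact hsep.dvd_of_dvd_mul_left hdvd

theorem isUnit_dirDerivGerm (h : eval P.rep (dirDeriv v F) ≠ 0) :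
    IsUnit (dirDerivGerm hF v hc) := by
  have hl : (linForm c ^ (f - 1)).IsHomogeneous (f - 1) := by
    simpa using (linForm_isHomogeneous c).pow (f - 1)
  refine IsUnit.of_mul_eq_one (germ hl (dirDeriv_isHomogeneous v hF) h) (Subtype.ext ?_)
  rw [Subalgebra.coe_mul, dirDerivGerm, coe_germ, coe_germ, Subalgebra.coe_one]
  have h1 := algebraMap_ne_zero_of_eval h
  have h2 : ι (linForm c ^ (f - 1)) ≠ 0 := algebraMap_ne_zero_of_eval (x := P.rep) (by
    rw [map_pow]; exact pow_ne_zero _ hc)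
  field_simp

end GeneralDirection

/-- The normalization of the local ring of a reduced curve has finite codimension over it, so that
the delta invariant, a `Module.finrank`, is the true dimension. -/
theorem finite_normalizationQuotient_curveLocalRing {F : MvPolynomial (Fin 3) Ω} {f : ℕ}
    (hF : F.IsHomogeneous f) {v : Fin 3 → Ω} (hv : v 0 ≠ 0) (hvF : eval v F ≠ 0)
    (hsep : IsRelPrime F (dirDeriv v F)) (hD0 : dirDeriv v F ≠ 0) (P : ℙ Ω (Fin 3 → Ω)) :
    Module.Finite Ω (NormalizationQuotient (curveLocalRing F P)) := by
  obtain ⟨c, hc⟩ := exists_linForm_ne_zero P.rep_nonzero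
  have hF0 : F ≠ 0 := fun h => hvF (by rw [h, map_zero])
  have hl : (linForm c ^ (f - 1)).IsHomogeneous (f - 1) := by
    simpa using (linForm_isHomogeneous c).pow (f - 1)
  have hfin : Module.Finite Ω
      (planeLocalRing P ⧸ curveIdeal F P ⊔ Ideal.span {dirDerivGerm hF v hc}) := by
    refine finite_quotient_of_isRelPrime hF (dirDeriv_isHomogeneous v hF) hF0 hD0 hsep _
      fun d hd N D hN hD hP hmem => ?_
    obtain ⟨U, W, hU, hW, rfl⟩ := exists_isHomogeneous_of_mem_span_pair hF
      (dirDeriv_isHomogeneous v hF) hN (m := d - f) (n := d - (f - 1)) (by omega) (by omega) hmem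
    have hFU : (F * U).IsHomogeneous d := by
      have := hF.mul hU
      rwa [show f + (d - f) = d by omega] at this
    have hWl : (W * linForm c ^ (f - 1)).IsHomogeneous d := by
      have := hW.mul hl
      rwa [show d - (f - 1) + (f - 1) = d by omega] at this
    have heq : germ hN hD hP = germ hFU hD hP + germ hWl hD hP * dirDerivGerm hF v hc := by
      apply Subtype.ext
      rw [Subalgebra.coe_add, Subalgebra.coe_mul, dirDerivGerm]
      simp only [coe_germ]
      have h1 := algebraMap_ne_zero_of_eval hP
      have h2 : ι (linForm c) ≠ 0 := algebraMap_ne_zero_of_eval hc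
      simp only [map_add, map_mul, map_pow]
      field_simp
    rw [heq]
    exact Submodule.add_mem_sup (mem_curveIdeal_of_dvd hFU hD hP (coe_germ _ _ _) ⟨U, rfl⟩)
      (Ideal.mul_mem_left _ _ (Ideal.mem_span_singleton_self _))
  exact finite_normalizationQuotient Ω (curveIdeal F P)
    (mem_curveIdeal_of_dirDerivGerm_mul_mem hF hc hsep)
    fun p q n b hq hb h => exists_dirDerivGerm_mul_sub_mem hF hv hvF hsep hc hq hb h

/-- The delta invariant vanishes at the points where the derivative in a general direction does
not. -/
theorem deltaAt_eq_zero {F : MvPolynomial (Fin 3) Ω} {f : ℕ}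
    (hF : F.IsHomogeneous f) {v : Fin 3 → Ω} (hv : v 0 ≠ 0) (hvF : eval v F ≠ 0)
    (hsep : IsRelPrime F (dirDeriv v F)) (hP : eval P.rep (dirDeriv v F) ≠ 0) :
    deltaAt F P = 0 := by
  obtain ⟨c, hc⟩ := exists_linForm_ne_zero P.rep_nonzero
  exact deltaInvariant_eq_zero Ω (curveIdeal F P) (isUnit_dirDerivGerm hF hc hP)
    fun p q n b hq hb h => exists_dirDerivGerm_mul_sub_mem hF hv hvF hsep hc hq hb h

/-- The linear map sending a form of degree `d` to its germ at `P`, its quotient by the `d`-th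
power of a linear form that does not vanish at `P`. -/
noncomputable def formGerm {c : Fin 3 → Ω} (hc : eval P.rep (linForm c) ≠ 0) (d : ℕ) :
    homogeneousSubmodule (Fin 3) Ω d →ₗ[Ω] planeLocalRing P where
  toFun G := germ G.2 (by simpa using (linForm_isHomogeneous c).pow d :
      (linForm c ^ d).IsHomogeneous d) (by rw [map_pow]; exact pow_ne_zero _ hc)
  map_add' G E := Subtype.ext (by
    change ι (G + E : MvPolynomial (Fin 3) Ω) / ι (linForm c ^ d) =
      ι G / ι (linForm c ^ d) + ι E / ι (linForm c ^ d)
    rw [map_add, add_div])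
  map_smul' u G := Subtype.ext (by
    change ι (u • (G : MvPolynomial (Fin 3) Ω)) / ι (linForm c ^ d) =
      u • (ι G / ι (linForm c ^ d))
    rw [smul_eq_C_mul, map_mul, mul_div_assoc, Algebra.smul_def,
      IsScalarTower.algebraMap_apply Ω (MvPolynomial (Fin 3) Ω), MvPolynomial.algebraMap_eq])

theorem coe_formGerm {c : Fin 3 → Ω} (hc : eval P.rep (linForm c) ≠ 0) {d : ℕ}
    (G : homogeneousSubmodule (Fin 3) Ω d) :
    (formGerm hc d G : FractionRing (MvPolynomial (Fin 3) Ω)) =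
      ι (G : MvPolynomial (Fin 3) Ω) / ι (linForm c) ^ d := by
  rw [← map_pow]
  rfl

/-- For a curve with components `H = 0` and `K = 0`, a linear map from the forms of degree `d` to
the normalization modulo the local ring of the curve, whose kernel consists of forms that lie
locally at `P` in the ideal `(H, K)`. It is the multiplication by the idempotent `H / (H + K)`,
where `H` and `K` are divided by powers of a linear form that does not vanish at `P`. -/
theorem exists_linearMap_forms {H K : MvPolynomial (Fin 3) Ω} {h k : ℕ} (hH : H.IsHomogeneous h)
    (hK : K.IsHomogeneous k) (hH0 : H ≠ 0) (hHK : IsRelPrime H K) (P : ℙ Ω (Fin 3 → Ω)) (d : ℕ) :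
    ∃ ψ : homogeneousSubmodule (Fin 3) Ω d →ₗ[Ω]
        NormalizationQuotient (curveLocalRing (H * K) P),
      ∀ G, ψ G = 0 → ∃ (e : ℕ) (D : MvPolynomial (Fin 3) Ω), D.IsHomogeneous e ∧
        eval P.rep D ≠ 0 ∧ D * (G : MvPolynomial (Fin 3) Ω) ∈ Ideal.span {H, K} := by
  obtain ⟨c, hc⟩ := exists_linForm_ne_zero P.rep_nonzero
  set l := linForm c
  have hl0 : ι l ≠ 0 := algebraMap_ne_zero_of_eval hc
  have hl : ∀ n, (l ^ n).IsHomogeneous n := fun n => by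
    simpa using (linForm_isHomogeneous c).pow n
  have hlP : ∀ n, eval P.rep (l ^ n) ≠ 0 := fun n => by
    rw [map_pow]
    exact pow_ne_zero _ hc
  let x := formGerm hc h ⟨H, hH⟩
  let y := formGerm hc k ⟨K, hK⟩
  have hx : (x : FractionRing (MvPolynomial (Fin 3) Ω)) = ι H / ι l ^ h := coe_formGerm hc _
  have hy : (y : FractionRing (MvPolynomial (Fin 3) Ω)) = ι K / ι l ^ k := coe_formGerm hc _
  have hxy : x * y ∈ curveIdeal (H * K) P := by
    refine mem_curveIdeal_of_dvd (hH.mul hK) ((hl h).mul (hl k))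
      (by rw [map_mul]; exact mul_ne_zero (hlP h) (hlP k)) ?_ dvd_rfl
    rw [Subalgebra.coe_mul, hx, hy, map_mul, map_mul, map_pow, map_pow, div_mul_div_comm]
  have hnz : ∀ r, (x + y) * r ∈ curveIdeal (H * K) P → r ∈ curveIdeal (H * K) P := by
    intro r hr
    obtain ⟨n, N, D, hN, hD, hP, hrN⟩ := r.2
    have hD0 := algebraMap_ne_zero_of_eval hP
    obtain ⟨e, T, hT, hTP, Y, hY⟩ := exists_dvd_of_mem_curveIdeal
      (N := (H * l ^ k + K * l ^ h) * N) (D := l ^ h * l ^ k * D)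
      (by rw [map_mul, map_mul]; exact mul_ne_zero (mul_ne_zero (hlP h) (hlP k)) hP)
      (by
        rw [Subalgebra.coe_mul, Subalgebra.coe_add, hx, hy, hrN]
        simp only [map_mul, map_add, map_pow]
        field_simp) hr
    refine mem_curveIdeal_of_dvd_mul hN hD hP (hT.mul ((hl h).mul (hl k)))
      (by rw [map_mul, map_mul]; exact mul_ne_zero hTP (mul_ne_zero (hlP h) (hlP k))) hrN ?_
    have h1 : H ∣ T * l ^ h * N := hHK.dvd_of_dvd_mul_left
      ⟨K * Y - T * l ^ k * N, by linear_combination hY⟩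
    have h2 : K ∣ T * l ^ k * N := hHK.symm.dvd_of_dvd_mul_left
      ⟨H * Y - T * l ^ h * N, by linear_combination hY⟩
    refine hHK.mul_dvd ?_ ?_
    · rw [show T * (l ^ h * l ^ k) * N = T * l ^ h * N * l ^ k by ring]
      exact h1.mul_right _
    · rw [show T * (l ^ h * l ^ k) * N = T * l ^ k * N * l ^ h by ring]
      exact h2.mul_right _
  obtain ⟨θ, hθ⟩ := exists_linearMap_normalizationQuotient_quotient Ω (curveIdeal (H * K) P) hxy hnz
  refine ⟨θ.comp (formGerm hc d), fun G hG => ?_⟩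
  obtain ⟨s, hs⟩ := hθ _ hG
  obtain ⟨n, N, E, hN, hE, hEP, hsN⟩ := s.2
  have hE0 := algebraMap_ne_zero_of_eval hEP
  have hGl : (formGerm hc d G : FractionRing (MvPolynomial (Fin 3) Ω)) = ι G / ι l ^ d :=
    coe_formGerm hc G
  obtain ⟨e, T, hT, hTP, Y, hY⟩ := exists_dvd_of_mem_curveIdeal
    (N := (G : MvPolynomial (Fin 3) Ω) * H * E * l ^ k - N * l ^ d * (H * l ^ k + K * l ^ h))
    (D := l ^ d * (l ^ h * l ^ k) * E)
    (by
      rw [map_mul, map_mul, map_mul]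
      exact mul_ne_zero (mul_ne_zero (hlP d) (mul_ne_zero (hlP h) (hlP k))) hEP)
    (by
      rw [Subalgebra.coe_sub, Subalgebra.coe_mul, Subalgebra.coe_mul, Subalgebra.coe_add, hx, hy,
        hsN, hGl]
      simp only [map_mul, map_add, map_sub, map_pow]
      field_simp) hs
  obtain ⟨W, hW⟩ : H ∣ T * l ^ d * l ^ h * N := hHK.dvd_of_dvd_mul_left
    ⟨T * G * E * l ^ k - T * N * l ^ d * l ^ k - K * Y, by linear_combination -hY⟩
  have hcancel : T * G * E * l ^ k = T * N * l ^ d * l ^ k + W * K + K * Y :=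
    mul_left_cancel₀ hH0 (by linear_combination hY + K * hW)
  refine ⟨_, T * E * (l ^ h * l ^ k), (hT.mul hE).mul ((hl h).mul (hl k)), ?_, ?_⟩
  · rw [map_mul, map_mul, map_mul]
    exact mul_ne_zero (mul_ne_zero hTP hEP) (mul_ne_zero (hlP h) (hlP k))
  · refine Ideal.mem_span_pair.2 ⟨W * l ^ k, (W + Y) * l ^ h, ?_⟩
    linear_combination (-l ^ h) * hcancel - l ^ k * hW

/-- The intersection number of two curves without common component is bounded by the total delta
invariant of their union. At each of the finitely many common zeros, the forms of a large degree map
linearly to the normalization modulo the local ring; by Max Noether's theorem, a form in the kernels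
of all these maps lies in the ideal `(H, K)`, which has codimension `h * k` in this degree. -/
theorem mul_le_totalDelta [IsAlgClosed Ω] {H K : MvPolynomial (Fin 3) Ω} {h k : ℕ}
    (hH : H.IsHomogeneous h) (hK : K.IsHomogeneous k) (hsq : Squarefree (H * K)) (hh : h ≠ 0) :
    h * k ≤ totalDelta (H * K) := by
  classical
  have hF := hH.mul hK
  have hF0 := hsq.ne_zero
  have hH0 := left_ne_zero_of_mul hF0
  have hK0 := right_ne_zero_of_mul hF0
  have hHK : IsRelPrime H K := fun w h1 h2 => hsq w (mul_dvd_mul h1 h2)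
  obtain ⟨v, hv, hvF, hsep⟩ := exists_isRelPrime_dirDeriv hF hsq
  have hD0 : dirDeriv v (H * K) ≠ 0 := by
    intro h0
    have hu : IsUnit (H * K) := hsep dvd_rfl (h0 ▸ dvd_zero _)
    have := (isUnit_iff_totalDegree_of_isReduced.1 hu).2
    rw [hF.totalDegree hF0] at this
    omega
  have hfin := finite_setOf_eval_eq_zero hF (dirDeriv_isHomogeneous v hF) hF0 hD0 hsep
  set T := hfin.toFinset
  have hT : ∀ P, P ∈ T ↔ eval P.rep (H * K) = 0 ∧ eval P.rep (dirDeriv v (H * K)) = 0 := fun P =>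
    hfin.mem_toFinset
  -- The points with nonzero delta invariant lie in the finite set `T`, so `finsum` is a true sum.
  have htotal : totalDelta (H * K) =
      ∑ P : T, Module.finrank Ω (NormalizationQuotient (curveLocalRing (H * K) P.1)) := by
    rw [totalDelta, finsum_eq_sum_of_support_subset (s := T)]
    · rw [← Finset.sum_coe_sort]
      refine Finset.sum_congr rfl fun P _ => ?_
      rw [finsum_eq_if, if_pos ((hT P).1 P.2).1]
      rfl
    · intro P hP
      rw [Function.mem_support, finsum_eq_if] at hP
      have h1 : eval P.rep (H * K) = 0 := by
        by_contra h1
        exact hP (if_neg h1)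
      rw [if_pos h1] at hP
      refine (hT P).2 ⟨h1, ?_⟩
      by_contra h2
      exact hP (deltaAt_eq_zero hF hv hvF hsep h2)
  obtain ⟨n, hn⟩ := mem_span_pair_of_forall_local hH hK hH0 hK0 hHK
  have hfinq := finite_normalizationQuotient_curveLocalRing hF hv hvF hsep hD0
  choose ψ hψ using fun P : T => exists_linearMap_forms hH hK hH0 hHK P.1 (h + k + n)
  let q : homogeneousSubmodule (Fin 3) Ω (h + k + n) →ₗ[Ω] MvPolynomial (Fin 3) Ω ⧸
      Ideal.span {H, K} :=
    (Ideal.Quotient.mkₐ Ω (Ideal.span {H, K})).toLinearMap.comp (Submodule.subtype _)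
  have hq : LinearMap.range q = formsMod (Ideal.span {H, K}) (h + k + n) := by
    rw [LinearMap.range_comp, Submodule.range_subtype, formsMod]
  rw [htotal, ← finrank_formsMod hH hK hH0 hK0 hHK n, ← hq]
  refine finrank_range_le_sum q ψ fun G hG => Ideal.Quotient.eq_zero_iff_mem.2 ?_
  refine hn _ (by omega) G G.2 fun P hHP hKP => ?_
  refine hψ ⟨P, (hT P).2 ⟨by rw [map_mul, hHP, zero_mul], ?_⟩⟩ G (hG _)
  rw [Derivation.leibniz, smul_eq_mul, smul_eq_mul, map_add, map_mul, map_mul, hHP, hKP, zero_mul,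
    zero_mul, add_zero]

end LocalRing

end PlaneCurve

theorem propositionP {k : Type*} [Field k] {Ω : Type*} [Field Ω] [Algebra k Ω] [IsAlgClosed Ω]
    (f : ℕ) (F : MvPolynomial (Fin 3) k) (hF : F.IsHomogeneous f)
    (hred : Squarefree (MvPolynomial.map (algebraMap k Ω) F))
    (h : ℕ) (H K : MvPolynomial (Fin 3) Ω)
    (hHK : MvPolynomial.map (algebraMap k Ω) F = H * K)
    (hH : H.totalDegree = h) (hle : h ≤ K.totalDegree) :
    (h : ℚ) * ((f : ℚ) - (h : ℚ)) ≤
      (1 / 2 : ℚ) * ((f : ℚ) - 1) * ((f : ℚ) - 2) -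
        (normalizationGenus (MvPolynomial.map (algebraMap k Ω) F) f : ℚ) := by
  have hFΩ := hF.map (algebraMap k Ω)
  rw [hHK] at hred hFΩ ⊢
  have h0 := hred.ne_zero
  have hdeg := MvPolynomial.totalDegree_mul_of_isDomain (left_ne_zero_of_mul h0)
    (right_ne_zero_of_mul h0)
  rw [hFΩ.totalDegree h0, hH] at hdeg
  have hgenus : (normalizationGenus (H * K) f : ℚ) =
      ((f - 1).choose 2 : ℕ) - (totalDelta (H * K) : ℚ) := by
    rw [normalizationGenus]
    push_cast
    rfl
  have hδ : (h : ℚ) * ((f : ℚ) - h) ≤ totalDelta (H * K) := by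
    rw [hdeg]
    push_cast
    rw [add_sub_cancel_left]
    rcases Nat.eq_zero_or_pos h with rfl | hpos
    · simp
    · have hHh := PlaneCurve.isHomogeneous_of_mul_left hFΩ h0
      rw [hH] at hHh
      exact_mod_cast PlaneCurve.mul_le_totalDelta hHh
        (PlaneCurve.isHomogeneous_of_mul_right hFΩ h0) hred hpos.ne'
  -- For `f = 0` the truncated subtraction gives `0`, while the right-hand side is `1`.
  have hchoose : (((f - 1).choose 2 : ℕ) : ℚ) ≤ (1 / 2 : ℚ) * ((f : ℚ) - 1) * ((f : ℚ) - 2) := by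
    rcases f with _ | f
    · norm_num
    · rw [Nat.add_sub_cancel, Nat.cast_choose_two]
      push_cast
      apply le_of_eq
      ring
  rw [hgenus]
  linarith
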